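/- Let $0<\alpha<\infty$ and $0<p\le\infty$, and let the Fock space $F^p_\alpha$ be the space of all entire functions $f$ such that $f(z)e^{-\frac{\alpha}{2}|z|^2}$ belongs to $L^p(\mathbb C,dA)$ (for $p=\infty$: is bounded on $\mathbb C$), where $dA$ is area measure. Sequences of points in $\mathbb C$ may be finite or infinite, and are considered with multiplicities and up to order. A sequence $Z$ is a \emph{zero sequence} for $F^p_\alpha$ if some $f\in F^p_\alpha$, not identically zero, has exactly $Z$ as its zeros, counting multiplicities. Let $I_Z$ be the vector space of all $f\in F^p_\alpha$ that vanish on $Z$, that is, have at each point a zero of order at least the multiplicity of this point in $Z$ (additional zeros are permitted). Let $\Lambda_\alpha=\{\omega_{mn}=\sqrt{\pi/\alpha}\,(m+in):m,n\in\mathbb Z\}$ and $$\sigma_\alpha(z)=z\prod_{(m,n)\ne(0,0)}\left(1-\frac z{\omega_{mn}}\right)\exp\left(\frac z{\omega_{mn}}+\frac{z^2}{2\omega_{mn}^2}\right).$$ (1) For every $k$ that is a positive integer or $\infty$, there is a zero sequence $Z$ for $F^p_\alpha$ with $\dim_{\mathbb C} I_Z=k$. (2) Let $N$ be the smallest positive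 integer with $Np>2$ if $p<\infty$, and let $N=0$ if $p=\infty$. Let $k$ be a positive integer and let $a_1,\dots,a_{N+k-1}$ be any distinct points of $\Lambda_\alpha$. Then $Z=\Lambda_\alpha\setminus\{a_1,\dots,a_{N+k-1}\}$ (every point with multiplicity one) is a zero sequence for $F^p_\alpha$ with $\dim_{\mathbb C} I_Z=k$. Moreover, $\sigma_\alpha(z)/\prod_{i=1}^{N+k-1}(z-a_i)$ extends to an entire function $g$ whose zeros, counting multiplicities, are exactly $Z$, and $$I_Z=\{gh: h \text{ a polynomial of degree at most } k-1\}.$$ (3) If $Z$ is a zero sequence for $F^p_\alpha$ with $\dim_{\mathbb C} I_Z=1$, then $Z$ is a \emph{maximal zero sequence}: $Z$ is a zero sequence for $F^p_\alpha$, $\dim_{\mathbb C} I_Z=1$, and for every $a\in\mathbb C$ the sequence $Z\cup\{a\}$ (with the multiplicity of $a$ raised by one) is not a zero sequence for $F^p_\alpha$. -/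

import Mathlib

open MeasureTheory
open scoped ENNReal

noncomputable section

/-- The Fock space `F^p_α`: entire functions `f` such that `z ↦ f z * exp (-(α / 2) * |z|^2)` is in
`L^p` of the plane with respect to area measure. For `p = ∞`, as `f` is continuous, this says that
the function is bounded; for `0 < p < ∞` the normalizing factor `α / π` of the norm does not
affect membership. -/
def fockSpace (α : ℝ) (p : ℝ≥0∞) : Submodule ℂ (ℂ → ℂ) where
  carrier := {f | Differentiable ℂ f ∧
    MemLp (fun z : ℂ => f z * (Real.exp (-(α / 2) * ‖z‖ ^ 2) : ℂ)) p volume}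
  add_mem' := by
    rintro f g ⟨hf, hf'⟩ ⟨hg, hg'⟩
    refine ⟨hf.add hg, ?_⟩
    have h := hf'.add hg'
    convert h using 1
    ext z
    simp [add_mul]
  zero_mem' := by
    refine ⟨differentiable_const 0, ?_⟩
    simp
  smul_mem' := by
    rintro c f ⟨hf, hf'⟩
    refine ⟨hf.const_smul c, ?_⟩
    have h := hf'.const_smul c
    convert h using 1
    ext z
    simp [mul_assoc]

/-- A sequence of points of the plane is recorded, up to the order of its terms, by its multiplicity
function `Z`: the point `z` occurs `Z z` times. The function `f` vanishes on `Z` if at every point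
`z` it has a zero of order at least `Z z`; other zeros are permitted. -/
def VanishesOn (f : ℂ → ℂ) (Z : ℂ → ℕ) : Prop :=
  ∀ z, (Z z : ℕ∞) ≤ analyticOrderAt f z

/-- The function `f` vanishes exactly on `Z`, counting multiplicities. -/
def VanishesExactlyOn (f : ℂ → ℂ) (Z : ℂ → ℕ) : Prop :=
  ∀ z, analyticOrderAt f z = (Z z : ℕ∞)

/-- `Z` is a zero sequence for `F^p_α`: some function of the space, not identically zero, vanishes
exactly on `Z`, counting multiplicities. -/
def IsZeroSequence (α : ℝ) (p : ℝ≥0∞) (Z : ℂ → ℕ) : Prop :=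
  ∃ f ∈ fockSpace α p, f ≠ 0 ∧ VanishesExactlyOn f Z

/-- The space `I_Z` of all functions in `F^p_α` that vanish on `Z`. -/
def vanishingSpace (α : ℝ) (p : ℝ≥0∞) (Z : ℂ → ℕ) : Submodule ℂ (ℂ → ℂ) where
  carrier := {f | f ∈ fockSpace α p ∧ VanishesOn f Z}
  add_mem' := by
    rintro f g ⟨hf, hf'⟩ ⟨hg, hg'⟩
    exact ⟨add_mem hf hg, fun z => (le_min (hf' z) (hg' z)).trans le_analyticOrderAt_add⟩
  zero_mem' := by
    refine ⟨zero_mem _, fun z => ?_⟩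
    have h : analyticOrderAt (0 : ℂ → ℂ) z = ⊤ := by
      rw [analyticOrderAt_eq_top]
      exact Filter.Eventually.of_forall fun _ => rfl
    rw [h]
    exact le_top
  smul_mem' := by
    rintro c f ⟨hf, hf'⟩
    refine ⟨Submodule.smul_mem _ c hf, fun z => ?_⟩
    have hc : AnalyticAt ℂ (fun _ : ℂ => c) z := analyticAt_const
    have h := analyticOrderAt_smul hc (hf.1.analyticAt z)
    have h' : analyticOrderAt (c • f) z = _ := h
    rw [h']
    exact (hf' z).trans le_add_self

/-- The dimension of `I_Z` as a complex vector space, as a natural number or `∞`. -/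
def vanishingDim (α : ℝ) (p : ℝ≥0∞) (Z : ℂ → ℕ) : ℕ∞ :=
  Cardinal.toENat (Module.rank ℂ (vanishingSpace α p Z))

/-- The sequence `Z ∪ {a}`: one more copy of the point `a` is added to `Z`. -/
def adjoinPoint (Z : ℂ → ℕ) (a : ℂ) : ℂ → ℕ :=
  Z + Pi.single a 1

/-- Maximal zero sequences: zero sequences that cannot be expanded to another zero sequence by
adding a point, and whose space `I_Z` is one-dimensional. -/
def IsMaximalZeroSequence (α : ℝ) (p : ℝ≥0∞) (Z : ℂ → ℕ) : Prop :=
  IsZeroSequence α p Z ∧ (∀ a : ℂ, ¬ IsZeroSequence α p (adjoinPoint Z a)) ∧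
    vanishingDim α p Z = 1

/-- The point `ω_{mn} = √(π / α) (m + i n)`, where `q = (m, n)`. -/
def latticePoint (α : ℝ) (q : ℤ × ℤ) : ℂ :=
  (Real.sqrt (Real.pi / α) : ℂ) * ((q.1 : ℂ) + Complex.I * (q.2 : ℂ))

/-- The square lattice `Λ_α`. -/
def squareLattice (α : ℝ) : Set ℂ :=
  Set.range (latticePoint α)

/-- The Weierstrass sigma function of the square lattice `Λ_α`. -/
def weierstrassSigma (α : ℝ) (z : ℂ) : ℂ :=
  z * ∏' q : {q : ℤ × ℤ // q ≠ (0, 0)},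
    ((1 - z / latticePoint α q) *
      Complex.exp (z / latticePoint α q + z ^ 2 / (2 * latticePoint α q ^ 2)))

/-- The sequence `Λ_α - S`: the points of `Λ_α` that are not in `S`, each with multiplicity one. -/
def latticeMinus (α : ℝ) (S : Finset ℂ) : ℂ → ℕ :=
  Set.indicator (squareLattice α \ (S : Set ℂ)) 1

/-- The smallest positive integer `N` with `N p > 2` if `p < ∞`, and `0` if `p = ∞`. -/
def criticalExponent (p : ℝ≥0∞) : ℕ :=
  if p = ⊤ then 0 else sInf {N : ℕ | 0 < N ∧ 2 < (N : ℝ≥0∞) * p}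

end

/-! The engine is that `|σ_α(z)| exp(-α |z|² / 2)` is periodic with respect to `Λ_α`. The second
logarithmic derivative of `σ` is `-℘`, so translation by a lattice vector multiplies `σ` by `c * exp
(η * z)`. Legendre's relation, which the symmetry under multiplication by `i` makes explicit for a
square lattice, gives `η`, and oddness gives `|c|`; they match the Gaussian because the cell has
area `π / α` (`PeriodPair.norm_sigma_square_mul_exp_add`).

The periodic weight is therefore bounded above, and bounded below away from the lattice. Dividing
`σ_α` by `n` linear factors gives `g`, with `|g| exp(-α |z|² / 2)` comparable to `|z|^(-n)` away
from the lattice. Near infinity, `|z|^(-N)` is in `L^p` and `|z|^(1 - N)` is not. With `n = N + k -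
1`, a nonzero polynomial `P` thus has `g P` in the Fock space exactly when `deg P ≤ k - 1`
(`mul_polynomial_mem_fockSpace`, `mul_polynomial_notMem_fockSpace`).

Every `f` in `I_Z` is `g h` with `h` entire. The pointwise bound `|f| ≤ C exp(α |z|² / 2)` controls
`h` on circles around lattice points, the maximum principle extends the control to the plane, and
Liouville's theorem makes `h` a polynomial (`exists_polynomial_of_mul_mem_fockSpace`). Infinite
dimension is realized by the empty sequence, since all polynomials lie in the space.

For maximality, if `f` vanished exactly on `Z ∪ {a}`, then `f` and `f / (z - a)` would be two
independent elements of `I_Z`. -/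

/-! ### Elementary factors. -/

/-- The Weierstrass elementary factor of genus two. -/
noncomputable def primaryFactor (w : ℂ) : ℂ := (1 - w) * Complex.exp (w + w ^ 2 / 2)

lemma hasDerivAt_primaryFactor (w : ℂ) :
    HasDerivAt primaryFactor (-w ^ 2 * Complex.exp (w + w ^ 2 / 2)) w := by
  have h1 : HasDerivAt (fun w : ℂ => w + w ^ 2 / 2) (1 + w) w := by
    have := (hasDerivAt_id w).add (((hasDerivAt_id w).pow 2).div_const 2)
    convert! this using 1
    simp
  have h2 := ((hasDerivAt_id w).const_sub 1).mul h1.cexp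
  convert! h2 using 1
  simp
  ring

@[fun_prop]
lemma differentiable_primaryFactor : Differentiable ℂ primaryFactor :=
  fun w => (hasDerivAt_primaryFactor w).differentiableAt

lemma primaryFactor_zero : primaryFactor 0 = 1 := by simp [primaryFactor]

lemma primaryFactor_eq_zero_iff {w : ℂ} : primaryFactor w = 0 ↔ w = 1 := by
  simp [primaryFactor, Complex.exp_ne_zero, sub_eq_zero, eq_comm (a := w)]

/-- The derivative is `-w ^ 2` times an exponential whose exponent has norm at most `2` on the unit
disc; the mean value inequality supplies the third power. Cubes are what a planar lattice can sum.
-/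
lemma norm_primaryFactor_sub_one_le {w : ℂ} (hw : ‖w‖ ≤ 1) :
    ‖primaryFactor w - 1‖ ≤ Real.exp 2 * ‖w‖ ^ 3 := by
  have h := (convex_closedBall (0 : ℂ) ‖w‖).norm_image_sub_le_of_norm_hasDerivWithin_le
    (f := primaryFactor) (f' := fun w => -w ^ 2 * Complex.exp (w + w ^ 2 / 2))
    (C := ‖w‖ ^ 2 * Real.exp 2) (x := 0) (y := w)
    (fun x _ => (hasDerivAt_primaryFactor x).hasDerivWithinAt) ?_ (by simp) (by simp)
  · rw [primaryFactor_zero, sub_zero] at h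
    linarith [show ‖w‖ ^ 2 * Real.exp 2 * ‖w‖ = Real.exp 2 * ‖w‖ ^ 3 by ring]
  · intro x hx
    have hx : ‖x‖ ≤ ‖w‖ := by simpa using hx
    rw [norm_mul, norm_neg, norm_pow, Complex.norm_exp]
    gcongr
    refine (Complex.re_le_norm _).trans ((norm_add_le _ _).trans ?_)
    rw [norm_div, norm_pow, Complex.norm_ofNat]
    have : ‖x‖ ≤ 1 := hx.trans hw
    nlinarith [norm_nonneg x]

/-! ### The sigma function of a lattice: zeros, logarithmic derivative, quasi-periodicity. -/

namespace PeriodPair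

variable (L : PeriodPair)

/-- The canonical product of genus two over the nonzero lattice points. The factor of the lattice
point `0` is `1`, by the convention on division by zero. -/
noncomputable def sigmaProd (z : ℂ) : ℂ := ∏' l : L.lattice, primaryFactor (z / l)

/-- The Weierstrass sigma function of a lattice. -/
noncomputable def sigma (z : ℂ) : ℂ := z * L.sigmaProd z

lemma summable_norm_inv_cube : Summable fun l : L.lattice => (‖(l : ℂ)‖⁻¹) ^ 3 :=
  ZLattice.summable_norm_pow_inv L.lattice 3 (by simp)

lemma eventually_le_norm (R : ℝ) : ∀ᶠ l : L.lattice in Filter.cofinite, R ≤ ‖(l : ℂ)‖ := by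
  refine (isCompact_iff_finite.mp (isCompact_closedBall (0 : L.lattice) R)).subset ?_
  intro l hl
  have : ‖(l : ℂ)‖ < R := by simpa using hl
  simpa using this.le

lemma eventually_norm_primaryFactor_le (R : ℝ) : ∀ᶠ l : L.lattice in Filter.cofinite,
    ∀ z ∈ Metric.ball (0 : ℂ) R,
      ‖primaryFactor (z / l) - 1‖ ≤ Real.exp 2 * R ^ 3 * (‖(l : ℂ)‖⁻¹) ^ 3 := by
  filter_upwards [L.eventually_le_norm R] with l hl z hz
  have hz : ‖z‖ < R := by simpa using hz
  have hR : 0 < R := (norm_nonneg z).trans_lt hz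
  have h1 : ‖z / (l : ℂ)‖ ≤ 1 := by
    rw [norm_div]
    exact div_le_one_of_le₀ (hz.le.trans hl) (norm_nonneg _)
  refine (norm_primaryFactor_sub_one_le h1).trans ?_
  rw [norm_div, div_eq_mul_inv, mul_pow, ← mul_assoc]
  gcongr

lemma hasProdLocallyUniformlyOn_sigmaProd (R : ℝ) :
    HasProdLocallyUniformlyOn (fun (l : L.lattice) (z : ℂ) => primaryFactor (z / l)) L.sigmaProd
      (Metric.ball 0 R) := by
  have h := Summable.hasProdLocallyUniformlyOn_one_add (f := fun (l : L.lattice) (z : ℂ) =>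
    primaryFactor (z / l) - 1) (Metric.isOpen_ball (x := (0 : ℂ)) (ε := R))
    (L.summable_norm_inv_cube.mul_left (Real.exp 2 * R ^ 3))
    (L.eventually_norm_primaryFactor_le R) ?_
  · simpa using! h
  · intro l
    have : Differentiable ℂ fun z : ℂ => primaryFactor (z / l) - 1 :=
      (differentiable_primaryFactor.comp (differentiable_id.div_const _)).sub_const 1
    exact this.continuous.continuousOn

lemma differentiable_sigmaProd : Differentiable ℂ L.sigmaProd := by
  intro z
  have h : DifferentiableOn ℂ L.sigmaProd (Metric.ball 0 (‖z‖ + 1)) := by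
    refine (L.hasProdLocallyUniformlyOn_sigmaProd (‖z‖ + 1)).differentiableOn
      (.of_forall fun s => .fun_finsetProd fun i hi => ?_) Metric.isOpen_ball
    exact (differentiable_primaryFactor.comp (differentiable_id.div_const _)).differentiableOn
  exact h.differentiableAt (Metric.isOpen_ball.mem_nhds (by simp))

lemma sigmaProd_zero : L.sigmaProd 0 = 1 := by simp [sigmaProd, primaryFactor_zero]

lemma summable_norm_primaryFactor_sub_one (z : ℂ) :
    Summable fun l : L.lattice => ‖primaryFactor (z / l) - 1‖ := by
  refine Summable.of_norm_bounded_eventually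
    (L.summable_norm_inv_cube.mul_left (Real.exp 2 * (‖z‖ + 1) ^ 3)) ?_
  filter_upwards [L.eventually_norm_primaryFactor_le (‖z‖ + 1)] with l hl
  simpa using hl z (by simp)

lemma sigmaProd_ne_zero {z : ℂ} (hz : z = 0 ∨ z ∉ L.lattice) : L.sigmaProd z ≠ 0 := by
  have h := tprod_one_add_ne_zero_of_summable
    (f := fun l : L.lattice => primaryFactor (z / l) - 1) ?_
    (L.summable_norm_primaryFactor_sub_one z)
  · simpa [sigmaProd] using h
  · intro l
    rw [add_sub_cancel, Ne, primaryFactor_eq_zero_iff]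
    rcases hz with rfl | hz
    · simp
    · intro h
      have hl : (l : ℂ) ≠ 0 := by
        intro h0
        simp [h0] at h
      exact hz ((div_eq_one_iff_eq hl).mp h ▸ l.2)

lemma sigmaProd_eq_zero {z : ℂ} (hz : z ∈ L.lattice) (h0 : z ≠ 0) : L.sigmaProd z = 0 := by
  refine (hasProd_zero_of_exists_eq_zero ⟨⟨z, hz⟩, ?_⟩).tprod_eq
  simp [primaryFactor_eq_zero_iff, h0]

@[fun_prop]
lemma differentiable_sigma : Differentiable ℂ L.sigma :=
  differentiable_id.mul L.differentiable_sigmaProd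

lemma sigma_eq_zero_iff {z : ℂ} : L.sigma z = 0 ↔ z ∈ L.lattice := by
  rw [sigma, mul_eq_zero]
  constructor
  · rintro (rfl | h)
    · exact zero_mem _
    · by_contra hz
      exact L.sigmaProd_ne_zero (Or.inr hz) h
  · intro hz
    by_cases h0 : z = 0
    · exact Or.inl h0
    · exact Or.inr (L.sigmaProd_eq_zero hz h0)

/-- Locally uniform domination: near a point off the lattice, the terms of the logarithmic
derivative are bounded by a multiple of `‖l‖⁻¹ ^ 3`, which justifies termwise differentiation. -/
lemma exists_forall_mul_norm_le {z₀ : ℂ} (hz₀ : z₀ ∉ L.lattice) :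
    ∃ δ > 0, ∃ c > 0, ∀ z ∈ Metric.ball z₀ δ, ∀ l ∈ L.lattice,
      0 < ‖z - l‖ ∧ c * ‖l‖ ≤ ‖z - l‖ := by
  obtain ⟨ε, hε, h⟩ := Metric.isOpen_iff.mp L.isClosed_lattice.isOpen_compl z₀ hz₀
  refine ⟨ε / 2, by positivity, (1 + (‖z₀‖ + ε) / (ε / 2))⁻¹, by positivity, fun z hz l hl => ?_⟩
  have hz : dist z z₀ < ε / 2 := hz
  have h1 : ε ≤ dist l z₀ := by
    by_contra! h2
    exact h h2 hl
  have h2 : ε / 2 ≤ ‖z - l‖ := by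
    rw [← dist_eq_norm]
    linarith [dist_triangle l z z₀, dist_comm l z]
  refine ⟨by linarith, ?_⟩
  rw [inv_mul_le_iff₀ (by positivity)]
  have h3 : ‖l‖ ≤ ‖z - l‖ + ‖z‖ := by
    have := norm_sub_le z (z - l)
    rw [sub_sub_cancel] at this
    linarith
  have h4 : ‖z‖ ≤ ‖z₀‖ + ε := by
    have := norm_add_le (z - z₀) z₀
    rw [sub_add_cancel, ← dist_eq_norm] at this
    linarith
  have h5 : ‖z₀‖ + ε ≤ (‖z₀‖ + ε) / (ε / 2) * ‖z - l‖ := by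
    rw [div_mul_eq_mul_div, le_div_iff₀ (by positivity)]
    gcongr
  linarith

lemma logDeriv_primaryFactor_div {z l : ℂ} (h : z ≠ l) :
    logDeriv (fun z : ℂ => primaryFactor (z / l)) z = z ^ 2 / (l ^ 2 * (z - l)) := by
  have hd : HasDerivAt (fun z : ℂ => primaryFactor (z / l))
      (-(z / l) ^ 2 * Complex.exp (z / l + (z / l) ^ 2 / 2) * (1 / l)) z :=
    HasDerivAt.comp (h₂ := primaryFactor) (h := fun z : ℂ => z / l) z
      (hasDerivAt_primaryFactor (z / l)) ((hasDerivAt_id z).div_const l)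
  rw [logDeriv_apply, hd.deriv, primaryFactor]
  by_cases hl : l = 0
  · simp [hl]
  have h1 : z - l ≠ 0 := sub_ne_zero.mpr h
  have h2 : 1 - z / l ≠ 0 := by
    rw [sub_ne_zero, ne_comm, Ne, div_eq_one_iff_eq hl]
    exact h
  have h3 : l - z ≠ 0 := sub_ne_zero.mpr h.symm
  have := Complex.exp_ne_zero (z / l + (z / l) ^ 2 / 2)
  rw [mul_right_comm, mul_div_mul_right _ _ this]
  rw [div_eq_div_iff h2 (by positivity)]
  field_simp
  ring

lemma norm_logDeriv_term_le {z l : ℂ} {c R : ℝ} (hc : 0 < c)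
    (h : c * ‖l‖ ≤ ‖z - l‖) (hR : ‖z‖ ≤ R) :
    ‖z ^ 2 / (l ^ 2 * (z - l))‖ ≤ R ^ 2 / c * (‖l‖⁻¹) ^ 3 := by
  by_cases hl : l = 0
  · simp [hl]
  have hl : 0 < ‖l‖ := norm_pos_iff.mpr hl
  rw [norm_div, norm_mul, norm_pow, norm_pow]
  calc ‖z‖ ^ 2 / (‖l‖ ^ 2 * ‖z - l‖) ≤ R ^ 2 / (‖l‖ ^ 2 * (c * ‖l‖)) := by gcongr
    _ = R ^ 2 / c * (‖l‖⁻¹) ^ 3 := by field_simp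

lemma logDeriv_sigmaProd {z : ℂ} (hz : z ∉ L.lattice) :
    logDeriv L.sigmaProd z = ∑' l : L.lattice, z ^ 2 / ((l : ℂ) ^ 2 * (z - l)) := by
  have hne : ∀ l : L.lattice, z ≠ l := fun l h => hz (h ▸ l.2)
  obtain ⟨δ, hδ, c, hc, h⟩ := L.exists_forall_mul_norm_le hz
  have h1 := logDeriv_tprod_eq_tsum (Metric.isOpen_ball (x := (0 : ℂ)) (ε := ‖z‖ + 1))
    (x := z) (f := fun (l : L.lattice) (z : ℂ) => primaryFactor (z / l)) (by simp) ?_ ?_ ?_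
    (L.hasProdLocallyUniformlyOn_sigmaProd _).multipliableLocallyUniformlyOn
    (L.sigmaProd_ne_zero (Or.inr hz))
  · refine h1.trans (tsum_congr fun l => logDeriv_primaryFactor_div (hne l))
  · intro l h0
    rw [primaryFactor_eq_zero_iff] at h0
    have hl : (l : ℂ) ≠ 0 := by
      intro h1
      simp [h1] at h0
    exact hne l ((div_eq_one_iff_eq hl).mp h0)
  · intro l
    exact (differentiable_primaryFactor.comp (differentiable_id.div_const _)).differentiableOn
  · simp_rw [fun l : L.lattice => logDeriv_primaryFactor_div (hne l)]
    refine Summable.of_norm_bounded (L.summable_norm_inv_cube.mul_left (‖z‖ ^ 2 / c)) fun l => ?_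
    have := h z (by simpa using hδ) l l.2
    exact norm_logDeriv_term_le hc this.2 le_rfl

/-- For `l ≠ 0` each term equals `1 / (z - l) + 1 / l + z / l ^ 2`, with derivative `-(1 / (z - l) ^
2 - 1 / l ^ 2)`: these are the terms of `-℘` without the one at `l = 0`. -/
lemma hasDerivAt_logDeriv_sigmaProd {z : ℂ} (hz : z ∉ L.lattice) :
    HasDerivAt (logDeriv L.sigmaProd) (-L.weierstrassPExcept 0 z) z := by
  obtain ⟨δ, hδ, c, hc, h⟩ := L.exists_forall_mul_norm_le hz
  set F : L.lattice → ℂ → ℂ := fun l z => z ^ 2 / ((l : ℂ) ^ 2 * (z - l)) with hF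
  have hU : Metric.ball z δ ∈ nhds z := Metric.ball_mem_nhds z hδ
  have hev : logDeriv L.sigmaProd =ᶠ[nhds z] fun w => ∑' l, F l w := by
    filter_upwards [hU] with w hw
    refine L.logDeriv_sigmaProd fun hw' => ?_
    have := (h w hw w hw').1
    simp at this
  have hdF : ∀ l : L.lattice, ∀ w ∈ Metric.ball z δ, HasDerivAt (F l)
      (-(if (l : ℂ) = 0 then 0 else (1 / (w - l) ^ 2 - 1 / (l : ℂ) ^ 2))) w := by
    intro l w hw
    have hwl : w - l ≠ 0 := norm_pos_iff.mp (h w hw l l.2).1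
    split_ifs with hl
    · have : F l = fun _ => 0 := by
        ext w
        simp [hF, hl]
      rw [this]
      simpa using hasDerivAt_const w (0 : ℂ)
    · have h1 := ((hasDerivAt_id w).pow 2).div
        (((hasDerivAt_id w).sub_const (l : ℂ)).const_mul ((l : ℂ) ^ 2))
        (mul_ne_zero (pow_ne_zero 2 hl) hwl)
      convert! h1 using 1
      simp
      field_simp
      ring
  have hbound : ∀ (l : L.lattice) (w : ℂ), w ∈ Metric.ball z δ →
      ‖F l w‖ ≤ (‖z‖ + δ) ^ 2 / c * (‖(l : ℂ)‖⁻¹) ^ 3 := by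
    intro l w hw
    have h1 := h w hw l l.2
    refine norm_logDeriv_term_le hc h1.2 ?_
    have := norm_add_le (w - z) z
    rw [sub_add_cancel, ← dist_eq_norm] at this
    have hw : dist w z < δ := hw
    linarith
  have hdiff : ∀ l, DifferentiableOn ℂ (F l) (Metric.ball z δ) := fun l w hw =>
    (hdF l w hw).differentiableAt.differentiableWithinAt
  have hsum := Complex.hasSum_deriv_of_summable_norm
    (L.summable_norm_inv_cube.mul_left ((‖z‖ + δ) ^ 2 / c)) hdiff Metric.isOpen_ball hbound
    (Metric.mem_ball_self hδ)
  have hd := (Complex.differentiableOn_tsum_of_summable_norm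
    (L.summable_norm_inv_cube.mul_left ((‖z‖ + δ) ^ 2 / c)) hdiff Metric.isOpen_ball
    hbound).differentiableAt hU
  have heq : deriv (fun w => ∑' l, F l w) z = -L.weierstrassPExcept 0 z := by
    refine hsum.unique ?_
    simp_rw [fun l => (hdF l z (Metric.mem_ball_self hδ)).deriv]
    exact (L.hasSum_weierstrassPExcept 0 z).neg
  exact (heq ▸ hd.hasDerivAt).congr_of_eventuallyEq hev

lemma logDeriv_sigma {z : ℂ} (hz : z ∉ L.lattice) :
    logDeriv L.sigma z = 1 / z + logDeriv L.sigmaProd z := by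
  have h0 : z ≠ 0 := fun h => hz (h ▸ zero_mem _)
  have h := logDeriv_mul (f := fun z : ℂ => z) (g := L.sigmaProd) z h0
    (L.sigmaProd_ne_zero (Or.inr hz)) differentiableAt_id (L.differentiable_sigmaProd z)
  rw [show L.sigma = fun z => z * L.sigmaProd z from rfl, h]
  simp [logDeriv_apply]

lemma hasDerivAt_logDeriv_sigma {z : ℂ} (hz : z ∉ L.lattice) :
    HasDerivAt (logDeriv L.sigma) (-L.weierstrassP z) z := by
  have h0 : z ≠ 0 := fun h => hz (h ▸ zero_mem _)
  have hev : logDeriv L.sigma =ᶠ[nhds z] fun w => w⁻¹ + logDeriv L.sigmaProd w := by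
    filter_upwards [L.isClosed_lattice.isOpen_compl.mem_nhds hz] with w hw
    rw [L.logDeriv_sigma hw, one_div]
  have h := (hasDerivAt_inv h0).add (L.hasDerivAt_logDeriv_sigmaProd hz)
  convert! h.congr_of_eventuallyEq hev using 1
  have := L.weierstrassPExcept_add 0 z
  rw [← this]
  simp

lemma countable_lattice : (L.lattice : Set ℂ).Countable :=
  Set.countable_coe_iff.mp (inferInstanceAs (Countable L.lattice))

/-- A countable set does not disconnect the plane. This turns a vanishing derivative off the lattice
into a single constant. -/
lemma isPreconnected_compl_lattice : IsPreconnected (L.lattice : Set ℂ)ᶜ :=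
  (L.countable_lattice.isConnected_compl_of_one_lt_rank
    (by simp [Complex.rank_real_complex])).isPreconnected

lemma dense_compl_lattice : Dense (L.lattice : Set ℂ)ᶜ :=
  L.countable_lattice.dense_compl ℝ

/-- The sigma function is quasi-periodic, and its logarithmic derivative is periodic up to an
additive constant. -/
theorem exists_sigma_add_eq {l : ℂ} (hl : l ∈ L.lattice) :
    ∃ η c : ℂ, c ≠ 0 ∧ (∀ z, z ∉ L.lattice → logDeriv L.sigma (z + l) = logDeriv L.sigma z + η) ∧
      ∀ z, L.sigma (z + l) = c * Complex.exp (η * z) * L.sigma z := by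
  have hadd : ∀ {z : ℂ}, z ∉ L.lattice → z + l ∉ L.lattice := fun {z} hz h =>
    hz (by simpa using sub_mem h hl)
  have hopen : IsOpen (L.lattice : Set ℂ)ᶜ := L.isClosed_lattice.isOpen_compl
  -- Periodicity of `℘` makes the increment of the logarithmic derivative constant; this is `η`.
  have hD : ∀ z ∈ (L.lattice : Set ℂ)ᶜ, HasDerivAt
      (fun z => logDeriv L.sigma (z + l) - logDeriv L.sigma z) 0 z := by
    intro z hz
    have h := ((L.hasDerivAt_logDeriv_sigma (hadd hz)).comp_add_const z l).sub
      (L.hasDerivAt_logDeriv_sigma hz)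
    convert! h using 1
    rw [L.weierstrassP_add_coe z ⟨l, hl⟩]
    simp
  obtain ⟨η, hη⟩ := hopen.exists_is_const_of_deriv_eq_zero L.isPreconnected_compl_lattice
    (fun z hz => (hD z hz).differentiableAt.differentiableWithinAt) (fun z hz => (hD z hz).deriv)
  -- A second integration: this quotient has zero logarithmic derivative, and its constant value is
  -- `c`.
  have hQ : ∀ z ∈ (L.lattice : Set ℂ)ᶜ, HasDerivAt
      (fun z => L.sigma (z + l) * Complex.exp (-(η * z)) / L.sigma z) 0 z := by
    intro z hz
    have hs : L.sigma z ≠ 0 := fun h => hz (L.sigma_eq_zero_iff.mp h)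
    have hs' : L.sigma (z + l) ≠ 0 := fun h => hadd hz (L.sigma_eq_zero_iff.mp h)
    have h1 := (L.differentiable_sigma (z + l)).hasDerivAt.comp_add_const z l
    have h2 : HasDerivAt (fun z : ℂ => Complex.exp (-(η * z)))
        (Complex.exp (-(η * z)) * (-(η * 1))) z :=
      (((hasDerivAt_id z).const_mul η).neg).cexp
    have h3 := (h1.mul h2).div (L.differentiable_sigma z).hasDerivAt hs
    convert! h3 using 1
    have h4 := hη z hz
    simp only [logDeriv_apply] at h4
    rw [div_sub_div _ _ hs' hs, div_eq_iff (mul_ne_zero hs' hs)] at h4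
    rw [eq_comm, div_eq_zero_iff]
    left
    simp only [Pi.mul_apply]
    linear_combination (Complex.exp (-(η * z))) * h4
  obtain ⟨c, hc⟩ := hopen.exists_is_const_of_deriv_eq_zero L.isPreconnected_compl_lattice
    (fun z hz => (hQ z hz).differentiableAt.differentiableWithinAt) (fun z hz => (hQ z hz).deriv)
  refine ⟨η, c, ?_, fun z hz => ?_, fun z => ?_⟩
  · obtain ⟨z, hz⟩ := L.dense_compl_lattice.nonempty
    have h1 := hc z hz
    have hs : L.sigma z ≠ 0 := fun h => hz (L.sigma_eq_zero_iff.mp h)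
    have hs' : L.sigma (z + l) ≠ 0 := fun h => hadd hz (L.sigma_eq_zero_iff.mp h)
    rw [← h1]
    exact div_ne_zero (mul_ne_zero hs' (Complex.exp_ne_zero _)) hs
  · have := hη z hz
    rw [sub_eq_iff_eq_add] at this
    rw [this, add_comm]
  · by_cases hz : z ∈ L.lattice
    · rw [L.sigma_eq_zero_iff.mpr hz, L.sigma_eq_zero_iff.mpr (add_mem hz hl), mul_zero]
    · have hs : L.sigma z ≠ 0 := fun h => hz (L.sigma_eq_zero_iff.mp h)
      have h1 := hc z hz
      simp only [div_eq_iff hs] at h1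
      rw [mul_right_comm, ← h1, mul_assoc, ← Complex.exp_add]
      simp

/-- Quasi-periodicity transports the simple zero at `0`, where the cofactor `sigmaProd` takes the
value `1`. -/
theorem analyticOrderAt_sigma {l : ℂ} (hl : l ∈ L.lattice) : analyticOrderAt L.sigma l = 1 := by
  obtain ⟨η, c, hc, -, h⟩ := L.exists_sigma_add_eq hl
  have ha : AnalyticAt ℂ L.sigma l := L.differentiable_sigma.analyticAt l
  refine (ha.analyticOrderAt_eq_natCast (n := 1)).mpr
    ⟨fun z => c * Complex.exp (η * (z - l)) * L.sigmaProd (z - l), ?_, ?_, ?_⟩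
  · refine Differentiable.analyticAt ?_ l
    have := L.differentiable_sigmaProd.comp (differentiable_id.sub_const l)
    refine Differentiable.mul ?_ this
    fun_prop
  · simp [sigmaProd_zero, hc]
  · refine Filter.Eventually.of_forall fun z => ?_
    have h1 := h (z - l)
    rw [sub_add_cancel] at h1
    rw [h1, sigma, pow_one, smul_eq_mul]
    ring

theorem analyticOrderAt_sigma_of_notMem {z : ℂ} (hz : z ∉ L.lattice) :
    analyticOrderAt L.sigma z = 0 :=
  (L.differentiable_sigma.analyticAt z).analyticOrderAt_eq_zero.mpr
    fun h => hz (L.sigma_eq_zero_iff.mp h)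

end PeriodPair

/-! ### Symmetries, the square lattice, and periodicity of the weighted modulus. -/

namespace PeriodPair

/-- Multiplication by `u` permutes the factors. It is used with `u = -1` for parity and `u = i` for
the square lattice. -/
lemma sigmaProd_mul_of_mul_mem (L : PeriodPair) {u : ℂ} (hu : u ≠ 0)
    (h : ∀ l, u * l ∈ L.lattice ↔ l ∈ L.lattice) (z : ℂ) :
    L.sigmaProd (u * z) = L.sigmaProd z := by
  let e : L.lattice ≃ L.lattice :=
    (Equiv.mulLeft₀ u hu).subtypeEquiv fun l => (h l).symm
  rw [sigmaProd, ← e.tprod_eq]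
  refine tprod_congr fun l => ?_
  have : ((e l : L.lattice) : ℂ) = u * l := rfl
  rw [this, mul_div_mul_left _ _ hu]

lemma sigmaProd_neg (L : PeriodPair) (z : ℂ) : L.sigmaProd (-z) = L.sigmaProd z := by
  simpa using L.sigmaProd_mul_of_mul_mem (u := -1) (by norm_num) (by simp) z

lemma sigma_neg (L : PeriodPair) (z : ℂ) : L.sigma (-z) = -L.sigma z := by
  rw [sigma, sigmaProd_neg, sigma, neg_mul]

lemma logDeriv_sigmaProd_mul (L : PeriodPair) {u : ℂ} (hu : u ≠ 0)
    (h : ∀ l, u * l ∈ L.lattice ↔ l ∈ L.lattice) (z : ℂ) :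
    logDeriv L.sigmaProd (u * z) = u⁻¹ * logDeriv L.sigmaProd z := by
  have h1 : HasDerivAt (fun z => L.sigmaProd (u * z)) (deriv L.sigmaProd (u * z) * (u * 1)) z :=
    HasDerivAt.comp (h₂ := L.sigmaProd) z (L.differentiable_sigmaProd (u * z)).hasDerivAt
      ((hasDerivAt_id z).const_mul u)
  have h2 : (fun z => L.sigmaProd (u * z)) = L.sigmaProd :=
    funext (L.sigmaProd_mul_of_mul_mem hu h)
  rw [h2] at h1
  rw [logDeriv_apply, logDeriv_apply, h1.deriv, L.sigmaProd_mul_of_mul_mem hu h]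
  field_simp

/-- The period pair `(a, a i)` of a square lattice. -/
noncomputable def square (a : ℝ) (ha : 0 < a) : PeriodPair where
  ω₁ := a
  ω₂ := a * Complex.I
  indep := by
    rw [LinearIndependent.pair_iff]
    intro s t h
    have h1 := congrArg Complex.re h
    have h2 := congrArg Complex.im h
    simp [ha.ne'] at h1 h2
    exact ⟨h1, h2⟩

section Square

variable {a : ℝ} (ha : 0 < a)

lemma mem_square_lattice {z : ℂ} :
    z ∈ (square a ha).lattice ↔ ∃ m n : ℤ, (m * a : ℂ) + n * (a * Complex.I) = z :=
  mem_lattice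

lemma I_mul_mem_square_lattice (z : ℂ) :
    Complex.I * z ∈ (square a ha).lattice ↔ z ∈ (square a ha).lattice := by
  have key : ∀ z ∈ (square a ha).lattice, Complex.I * z ∈ (square a ha).lattice := by
    intro z hz
    obtain ⟨m, n, rfl⟩ := (mem_square_lattice ha).mp hz
    refine (mem_square_lattice ha).mpr ⟨-n, m, ?_⟩
    push_cast
    linear_combination -(n * a : ℂ) * Complex.I_mul_I
  refine ⟨fun h => ?_, key z⟩
  have := neg_mem (key _ h)
  rwa [← mul_assoc, Complex.I_mul_I, neg_one_mul, neg_neg] at this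

lemma exists_int_of_mem_square_lattice {z : ℂ} (hz : z ∈ (square a ha).lattice) :
    ∃ m n : ℤ, z.re = m * a ∧ z.im = n * a := by
  obtain ⟨m, n, rfl⟩ := (mem_square_lattice ha).mp hz
  exact ⟨m, n, by simp, by simp⟩

lemma eq_zero_of_mem_square_lattice {z : ℂ} (hz : z ∈ (square a ha).lattice)
    (hre : |z.re| < a) (him : |z.im| < a) : z = 0 := by
  obtain ⟨m, n, h1, h2⟩ := exists_int_of_mem_square_lattice ha hz
  have key : ∀ k : ℤ, |(k : ℝ) * a| < a → k = 0 := by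
    intro k hk
    rw [abs_mul, abs_of_pos ha] at hk
    have h3 : |(k : ℝ)| < 1 := by nlinarith
    exact Int.abs_lt_one_iff.mp (by exact_mod_cast h3)
  rw [h1] at hre
  rw [h2] at him
  apply Complex.ext
  · simp [h1, key m hre]
  · simp [h2, key n him]

lemma notMem_square_lattice_of_abs_re {z : ℂ} (h : |z.re| = a / 2) :
    z ∉ (square a ha).lattice := by
  intro hz
  obtain ⟨m, n, h1, -⟩ := exists_int_of_mem_square_lattice ha hz
  rw [h1, abs_mul, abs_of_pos ha] at h
  have h2 : 2 * |(m : ℝ)| = 1 := by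
    have : a * (2 * |(m : ℝ)|) = a * 1 := by linarith
    exact mul_left_cancel₀ ha.ne' this
  have h3 : 2 * |m| = 1 := by exact_mod_cast h2
  omega

/-- Cauchy's theorem on the central cell, whose closure contains no zero of `sigmaProd`. Under the
symmetries by `i` and `-1` the four sides contribute equally, so the boundary integral is `4 i`
times the one in question. -/
lemma integral_logDeriv_sigmaProd_square :
    ∫ y in (-(a / 2))..(a / 2), logDeriv (square a ha).sigmaProd (a / 2 + y * Complex.I) = 0 := by
  set L := square a ha
  have hI := L.logDeriv_sigmaProd_mul Complex.I_ne_zero (I_mul_mem_square_lattice ha)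
  have hneg : ∀ z, logDeriv L.sigmaProd (-z) = -logDeriv L.sigmaProd z := by
    intro z
    have := L.logDeriv_sigmaProd_mul (u := -1) (by norm_num) (by simp) z
    simpa [inv_neg] using this
  have hdiff : DifferentiableOn ℂ (logDeriv L.sigmaProd)
      (Set.uIcc (-(a / 2)) (a / 2) ×ℂ Set.uIcc (-(a / 2)) (a / 2)) := by
    intro z hz
    rw [Complex.mem_reProdIm, Set.uIcc_of_le (by linarith), Set.mem_Icc, Set.mem_Icc, ← abs_le,
      ← abs_le] at hz
    have h0 : L.sigmaProd z ≠ 0 := by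
      apply L.sigmaProd_ne_zero
      by_cases h : z ∈ L.lattice
      · exact Or.inl (eq_zero_of_mem_square_lattice ha h (by linarith [hz.1]) (by linarith [hz.2]))
      · exact Or.inr h
    exact ((L.differentiable_sigmaProd.analyticAt z).deriv.differentiableAt.div
      (L.differentiable_sigmaProd z) h0).differentiableWithinAt
  have hrect := Complex.integral_boundary_rect_eq_zero_of_differentiableOn (logDeriv L.sigmaProd)
    ⟨-(a / 2), -(a / 2)⟩ ⟨a / 2, a / 2⟩ hdiff
  simp only at hrect
  set J := ∫ y in (-(a / 2))..(a / 2), logDeriv L.sigmaProd (a / 2 + y * Complex.I) with hJ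
  have hJneg : ∫ y in (-(a / 2))..(a / 2), logDeriv L.sigmaProd (a / 2 - y * Complex.I) = J := by
    have := intervalIntegral.integral_comp_neg (a := -(a / 2)) (b := a / 2)
      (fun y : ℝ => logDeriv L.sigmaProd (a / 2 + y * Complex.I))
    rw [neg_neg] at this
    rw [hJ, ← this]
    congr 1
    ext y
    push_cast
    ring_nf
  have hbot : ∫ x in (-(a / 2))..(a / 2),
      logDeriv L.sigmaProd (x + ((-(a / 2) : ℝ) : ℂ) * Complex.I) = Complex.I * J := by
    rw [hJ, ← intervalIntegral.integral_const_mul]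
    congr 1
    ext x
    have h1 : (a / 2 + x * Complex.I : ℂ) =
        Complex.I * (x + ((-(a / 2) : ℝ) : ℂ) * Complex.I) := by
      push_cast
      linear_combination (a / 2 : ℂ) * Complex.I_mul_I
    rw [h1, hI, ← mul_assoc, mul_inv_cancel₀ Complex.I_ne_zero, one_mul]
  have htop : ∫ x in (-(a / 2))..(a / 2),
      logDeriv L.sigmaProd (x + ((a / 2 : ℝ) : ℂ) * Complex.I) = Complex.I⁻¹ * J := by
    rw [← hJneg, ← intervalIntegral.integral_const_mul]
    congr 1
    ext x
    rw [← hI]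
    congr 1
    push_cast
    linear_combination (x : ℂ) * Complex.I_mul_I
  have hleft : ∫ y in (-(a / 2))..(a / 2),
      logDeriv L.sigmaProd (((-(a / 2) : ℝ) : ℂ) + y * Complex.I) = -J := by
    rw [← hJneg, ← intervalIntegral.integral_neg]
    congr 1
    ext y
    rw [← hneg]
    congr 1
    push_cast
    ring
  have hright : ∫ y in (-(a / 2))..(a / 2),
      logDeriv L.sigmaProd (((a / 2 : ℝ) : ℂ) + y * Complex.I) = J := by
    rw [hJ]
    push_cast
    rfl
  rw [hbot, htop, hleft, hright, Complex.inv_I, smul_eq_mul, smul_eq_mul] at hrect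
  have : 4 * Complex.I * J = 0 := by linear_combination hrect
  simpa [Complex.I_ne_zero] using this

lemma integral_div_sq_add_sq {a : ℝ} (ha : 0 < a) :
    ∫ y in (-(a / 2))..(a / 2), a / (a ^ 2 / 4 + y ^ 2) = Real.pi := by
  have hd : ∀ y ∈ Set.uIcc (-(a / 2)) (a / 2),
      HasDerivAt (fun y => 2 * Real.arctan (2 / a * y)) (a / (a ^ 2 / 4 + y ^ 2)) y := by
    intro y _
    have h := (((hasDerivAt_id y).const_mul (2 / a)).arctan).const_mul 2
    convert! h using 1
    have h1 : a ^ 2 / 4 + y ^ 2 ≠ 0 := by positivity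
    have h2 : 1 + (2 / a * y) ^ 2 ≠ 0 := by positivity
    simp only [id, mul_one]
    field_simp
    ring
  rw [intervalIntegral.integral_eq_sub_of_hasDerivAt hd]
  · have h1 : 2 / a * (a / 2) = 1 := by field_simp
    rw [mul_neg, h1, Real.arctan_neg, Real.arctan_one]
    ring
  · refine Continuous.intervalIntegrable ?_ _ _
    refine continuous_const.div (by fun_prop) fun y => ?_
    positivity

/-- Legendre's relation for a square lattice. -/
lemma eta_mul_eq_pi {η : ℂ} (h : ∀ z, z ∉ (square a ha).lattice →
    logDeriv (square a ha).sigma (z + a) = logDeriv (square a ha).sigma z + η) :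
    η * a = Real.pi := by
  have hJ := integral_logDeriv_sigmaProd_square ha
  set L := square a ha
  have hneg : ∀ z, logDeriv L.sigmaProd (-z) = -logDeriv L.sigmaProd z := by
    intro z
    have := L.logDeriv_sigmaProd_mul (u := -1) (by norm_num) (by simp) z
    simpa [inv_neg] using this
  have hJneg :
      ∫ y in (-(a / 2))..(a / 2), logDeriv L.sigmaProd (a / 2 - y * Complex.I) = 0 := by
    have := intervalIntegral.integral_comp_neg (a := -(a / 2)) (b := a / 2)
      (fun y : ℝ => logDeriv L.sigmaProd (a / 2 + y * Complex.I))
    rw [neg_neg] at this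
    rw [← hJ, ← this]
    congr 1
    ext y
    push_cast
    ring_nf
  have hnot : ∀ y : ℝ, (a / 2 + y * Complex.I : ℂ) ∉ L.lattice := fun y =>
    notMem_square_lattice_of_abs_re ha (by simp [abs_of_pos (half_pos ha)])
  have hnot' : ∀ y : ℝ, (-(a / 2 - y * Complex.I) : ℂ) ∉ L.lattice := fun y =>
    notMem_square_lattice_of_abs_re ha (by simp [abs_of_pos (half_pos ha)])
  have hcont : ∀ u : ℂ, (∀ y : ℝ, (a / 2 + y * u : ℂ) ∉ L.lattice) →
      Continuous fun y : ℝ => logDeriv L.sigmaProd (a / 2 + y * u) := by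
    intro u hu
    refine continuous_iff_continuousAt.mpr fun y => ?_
    have h1 := (L.hasDerivAt_logDeriv_sigmaProd (hu y)).continuousAt
    exact ContinuousAt.comp (g := logDeriv L.sigmaProd) h1 (by fun_prop)
  have hc1 := hcont Complex.I hnot
  have hc2 : Continuous fun y : ℝ => logDeriv L.sigmaProd (a / 2 - y * Complex.I) := by
    have := hc1.comp (continuous_neg (G := ℝ))
    simpa [Function.comp_def, sub_eq_add_neg] using this
  -- The points `-(a / 2 - i y)` and `a / 2 + i y` differ by the period `a`. Oddness turns the
  -- increment `η` into a sum of two terms with integral zero, and the poles `1 / z` leave a kernel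
  -- of integral `π`.
  have key : ∀ y : ℝ, logDeriv L.sigmaProd (a / 2 + y * Complex.I) +
      logDeriv L.sigmaProd (a / 2 - y * Complex.I) =
        η - ((a / (a ^ 2 / 4 + y ^ 2) : ℝ) : ℂ) := by
    intro y
    have h1 := h _ (hnot' y)
    rw [show (-(a / 2 - y * Complex.I) + a : ℂ) = a / 2 + y * Complex.I by ring,
      L.logDeriv_sigma (hnot y), L.logDeriv_sigma (hnot' y), hneg] at h1
    have h2 : (a / 2 + y * Complex.I : ℂ) ≠ 0 := fun h0 => hnot y (h0 ▸ zero_mem _)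
    have h3 : (-(a / 2 - y * Complex.I) : ℂ) ≠ 0 := fun h0 => hnot' y (h0 ▸ zero_mem _)
    have h3' : (a / 2 - y * Complex.I : ℂ) ≠ 0 := neg_ne_zero.mp h3
    have h4 : (a ^ 2 / 4 + y ^ 2 : ℂ) =
        (a / 2 + y * Complex.I) * (a / 2 - y * Complex.I) := by
      linear_combination (y ^ 2 : ℂ) * Complex.I_mul_I
    have h5 : ((a / (a ^ 2 / 4 + y ^ 2) : ℝ) : ℂ) =
        1 / (a / 2 + y * Complex.I) + 1 / (a / 2 - y * Complex.I) := by
      push_cast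
      rw [h4, div_add_div _ _ h2 h3']
      ring
    rw [h5]
    rw [one_div_neg_eq_neg_one_div] at h1
    linear_combination h1
  have hcont2 : Continuous fun y : ℝ => ((a / (a ^ 2 / 4 + y ^ 2) : ℝ) : ℂ) := by
    refine Complex.continuous_ofReal.comp (continuous_const.div (by fun_prop) fun y => ?_)
    positivity
  have hint : (∫ y in (-(a / 2))..(a / 2), (η - ((a / (a ^ 2 / 4 + y ^ 2) : ℝ) : ℂ))) = 0 := by
    rw [← add_zero (0 : ℂ)]
    nth_rw 1 [← hJ]
    rw [← hJneg, ← intervalIntegral.integral_add (hc1.intervalIntegrable _ _)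
      (hc2.intervalIntegrable _ _)]
    exact intervalIntegral.integral_congr fun y _ => (key y).symm
  rw [intervalIntegral.integral_sub (by simp) (hcont2.intervalIntegrable _ _),
    intervalIntegral.integral_const, intervalIntegral.integral_ofReal,
    integral_div_sq_add_sq ha, Complex.real_smul] at hint
  push_cast at hint
  linear_combination hint

lemma norm_sigma_square_add (z : ℂ) :
    ‖(square a ha).sigma (z + a)‖ =
      Real.exp (Real.pi / 2 + Real.pi / a * z.re) * ‖(square a ha).sigma z‖ := by
  set L := square a ha
  obtain ⟨η, c, hc, h1, h2⟩ := L.exists_sigma_add_eq L.ω₁_mem_lattice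
  rw [show L.ω₁ = (a : ℂ) from rfl] at h1 h2
  have ha' : (a : ℂ) ≠ 0 := by exact_mod_cast ha.ne'
  have hη : η = ((Real.pi / a : ℝ) : ℂ) := by
    have := eta_mul_eq_pi ha h1
    push_cast
    rw [eq_div_iff ha', this]
  have hs : L.sigma (a / 2) ≠ 0 := fun h => by
    have := L.sigma_eq_zero_iff.mp h
    refine notMem_square_lattice_of_abs_re ha (z := a / 2)
      (by simp [abs_of_pos (half_pos ha)]) this
  -- At `-a / 2` the translate is `a / 2`; since `σ` is odd, this determines `|c|`.
  have h3 := h2 (-(a / 2))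
  rw [show (-(a / 2) + a : ℂ) = a / 2 by ring, L.sigma_neg] at h3
  have h4 : ‖c‖ * Real.exp (-(Real.pi / 2)) = 1 := by
    have h5 := congrArg norm h3
    have h6 : (η * -(a / 2)).re = -(Real.pi / 2) := by
      rw [hη, show ((Real.pi / a : ℝ) : ℂ) * -(a / 2) = ((-(Real.pi / 2) : ℝ) : ℂ) by
        push_cast; field_simp]
      exact Complex.ofReal_re _
    rw [norm_mul, norm_mul, norm_neg, Complex.norm_exp, h6] at h5
    exact (mul_right_cancel₀ (norm_ne_zero_iff.mpr hs) ((one_mul _).trans h5)).symm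
  have h7 : ‖c‖ = Real.exp (Real.pi / 2) := by
    rwa [Real.exp_neg, mul_inv_eq_one₀ (Real.exp_ne_zero _)] at h4
  rw [h2 z, norm_mul, norm_mul, h7, Complex.norm_exp, hη, Complex.re_ofReal_mul, Real.exp_add]

/-- The function `|σ(z)| exp(-π |z|² / (2 a²))` of a square lattice is periodic. -/
theorem norm_sigma_square_mul_exp_add {l : ℂ} (hl : l ∈ (square a ha).lattice) (z : ℂ) :
    ‖(square a ha).sigma (z + l)‖ * Real.exp (-(Real.pi / (2 * a ^ 2)) * ‖z + l‖ ^ 2) =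
      ‖(square a ha).sigma z‖ * Real.exp (-(Real.pi / (2 * a ^ 2)) * ‖z‖ ^ 2) := by
  set L := square a ha
  set Φ : ℂ → ℝ := fun z => ‖L.sigma z‖ * Real.exp (-(Real.pi / (2 * a ^ 2)) * ‖z‖ ^ 2) with hΦ
  have h1 : Function.Periodic Φ (a : ℂ) := by
    intro z
    -- The multiplier and the Gaussian cancel because `‖z + a‖ ^ 2 - ‖z‖ ^ 2 = 2 * a * z.re + a ^
    -- 2`.
    simp only [hΦ]
    rw [norm_sigma_square_add ha, mul_right_comm, ← Real.exp_add, mul_comm]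
    congr 2
    rw [← Complex.normSq_eq_norm_sq, ← Complex.normSq_eq_norm_sq, Complex.normSq_apply,
      Complex.normSq_apply]
    simp only [Complex.add_re, Complex.ofReal_re, Complex.add_im, Complex.ofReal_im, add_zero]
    field_simp
    ring
  -- Rotation invariance converts the period `a` into the period `a i`, so no second Legendre
  -- computation is needed.
  have hI : ∀ z, Φ (Complex.I * z) = Φ z := by
    intro z
    simp only [hΦ, sigma]
    rw [L.sigmaProd_mul_of_mul_mem Complex.I_ne_zero (I_mul_mem_square_lattice ha)]
    simp
  have h2 : Function.Periodic Φ (a * Complex.I : ℂ) := by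
    intro z
    rw [← hI z, ← h1 (Complex.I * z), ← neg_neg (a : ℂ)]
    have h3 : (Complex.I * z + - -(a : ℂ)) = Complex.I * (z + -(a * Complex.I)) := by
      linear_combination (a : ℂ) * Complex.I_mul_I
    rw [h3, hI]
    have h4 : ∀ z, Φ (z + -(a * Complex.I)) = Φ z := by
      intro z
      rw [← hI, mul_add, show Complex.I * -(a * Complex.I) = (a : ℂ) by
        linear_combination -(a : ℂ) * Complex.I_mul_I, h1, hI]
    rw [h4]
    have h5 := h4 (z + a * Complex.I)
    rw [add_neg_cancel_right] at h5
    simpa using h5.symm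
  obtain ⟨m, n, rfl⟩ := (mem_square_lattice ha).mp hl
  exact (h1.int_mul m).add_period (h2.int_mul n) z

end Square

end PeriodPair

/-! ### Identification of `σ_α` with the sigma function of a square lattice. -/

section WeierstrassSigma

variable {α : ℝ}

lemma latticePoint_injective (hα : 0 < α) : Function.Injective (latticePoint α) := by
  intro q r h
  have h0 : ((Real.sqrt (Real.pi / α) : ℝ) : ℂ) ≠ 0 := by
    have : 0 < Real.sqrt (Real.pi / α) := Real.sqrt_pos.mpr (by positivity)
    exact_mod_cast this.ne'
  have h1 := mul_left_cancel₀ h0 h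
  have h2 := congrArg Complex.re h1
  have h3 := congrArg Complex.im h1
  simp at h2 h3
  exact Prod.ext h2 h3

/-- The period pair of the lattice `Λ_α`. -/
noncomputable def fockPeriods (α : ℝ) (hα : 0 < α) : PeriodPair :=
  PeriodPair.square (Real.sqrt (Real.pi / α)) (Real.sqrt_pos.mpr (by positivity))

lemma latticeEquivProd_symm_fockPeriods (hα : 0 < α) (q : ℤ × ℤ) :
    (((fockPeriods α hα).latticeEquivProd.symm q : (fockPeriods α hα).lattice) : ℂ) =
      latticePoint α q := by
  rw [PeriodPair.latticeEquiv_symm_apply, latticePoint]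
  simp only [fockPeriods, PeriodPair.square]
  ring

lemma mem_squareLattice_iff (hα : 0 < α) {z : ℂ} :
    z ∈ squareLattice α ↔ z ∈ (fockPeriods α hα).lattice := by
  constructor
  · rintro ⟨q, rfl⟩
    rw [← latticeEquivProd_symm_fockPeriods hα]
    exact Subtype.coe_prop _
  · intro hz
    refine ⟨(fockPeriods α hα).latticeEquivProd ⟨z, hz⟩, ?_⟩
    rw [← latticeEquivProd_symm_fockPeriods hα]
    simp

lemma weierstrassSigma_eq (hα : 0 < α) : weierstrassSigma α = (fockPeriods α hα).sigma := by
  ext z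
  rw [weierstrassSigma, PeriodPair.sigma, PeriodPair.sigmaProd,
    ← (fockPeriods α hα).latticeEquivProd.symm.toEquiv.tprod_eq]
  congr 1
  have h : ∀ q : ℤ × ℤ, primaryFactor (z / latticePoint α q) =
      (1 - z / latticePoint α q) *
      Complex.exp (z / latticePoint α q + z ^ 2 / (2 * latticePoint α q ^ 2)) := by
    intro q
    rw [primaryFactor, div_pow, div_div, mul_comm (2 : ℂ)]
  have h2 : ∀ q : ℤ × ℤ, primaryFactor
      (z / ((fockPeriods α hα).latticeEquivProd.symm.toEquiv q : (fockPeriods α hα).lattice)) =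
      primaryFactor (z / latticePoint α q) := by
    intro q
    rw [← latticeEquivProd_symm_fockPeriods hα]
    rfl
  simp_rw [h2, ← h]
  refine tprod_subtype_eq_of_mulSupport_subset
    (f := fun q : ℤ × ℤ => primaryFactor (z / latticePoint α q)) (s := {q | q ≠ (0, 0)}) ?_
  intro q hq h0
  refine hq ?_
  rw [show q = (0, 0) from h0]
  simp [latticePoint, primaryFactor_zero]

lemma norm_weierstrassSigma_mul_exp_add (hα : 0 < α) {l : ℂ} (hl : l ∈ squareLattice α) (z : ℂ) :
    ‖weierstrassSigma α (z + l)‖ * Real.exp (-(α / 2) * ‖z + l‖ ^ 2) =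
      ‖weierstrassSigma α z‖ * Real.exp (-(α / 2) * ‖z‖ ^ 2) := by
  have h := PeriodPair.norm_sigma_square_mul_exp_add
    (a := Real.sqrt (Real.pi / α)) (Real.sqrt_pos.mpr (by positivity))
    ((mem_squareLattice_iff hα).mp hl) z
  have h1 : Real.pi / (2 * Real.sqrt (Real.pi / α) ^ 2) = α / 2 := by
    rw [Real.sq_sqrt (by positivity)]
    field_simp
  rw [h1] at h
  rw [weierstrassSigma_eq hα]
  exact h

end WeierstrassSigma

/-! ### Division of entire functions and polynomial growth. -/

section EntireFunctions

/-- An entire function that vanishes to at least the order of another one is a multiple of it. -/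
lemma exists_eq_mul_of_analyticOrderAt_le {f g : ℂ → ℂ} (hf : Differentiable ℂ f)
    (hg : Differentiable ℂ g) (hg0 : ∀ z, analyticOrderAt g z ≠ ⊤)
    (hfg : ∀ z, analyticOrderAt g z ≤ analyticOrderAt f z) :
    ∃ h : ℂ → ℂ, Differentiable ℂ h ∧ ∀ z, f z = g z * h z := by
  have hmf : MeromorphicOn f Set.univ := fun z _ => (hf.analyticAt z).meromorphicAt
  have hmg : MeromorphicOn g Set.univ := fun z _ => (hg.analyticAt z).meromorphicAt
  have hm : MeromorphicOn (f * g⁻¹) Set.univ := hmf.mul hmg.inv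
  -- The normal form fills in the removable singularities of `f / g`: its orders are nonnegative,
  -- hence it is analytic.
  set q := toMeromorphicNFOn (f * g⁻¹) Set.univ with hq
  have hqa : ∀ z, AnalyticAt ℂ q z := by
    intro z
    have h1 := (meromorphicNFOn_toMeromorphicNFOn (f * g⁻¹) Set.univ) (Set.mem_univ z)
    refine h1.meromorphicOrderAt_nonneg_iff_analyticAt.mp ?_
    rw [meromorphicOrderAt_toMeromorphicNFOn hm (Set.mem_univ z),
      meromorphicOrderAt_mul (hmf z trivial) (hmg z trivial).inv, meromorphicOrderAt_inv,
      (hf.analyticAt z).meromorphicOrderAt_eq, (hg.analyticAt z).meromorphicOrderAt_eq]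
    have h2 := hfg z
    have h3 := hg0 z
    generalize analyticOrderAt g z = a at h2 h3 ⊢
    generalize analyticOrderAt f z = b at h2 ⊢
    lift a to ℕ using h3
    by_cases hb : b = ⊤
    · subst hb
      simp
    · lift b to ℕ using hb
      have h4 : a ≤ b := by exact_mod_cast h2
      have : (0 : ℤ) ≤ (b : ℤ) + -(a : ℤ) := by omega
      simp only [ENat.map_natCast]
      exact_mod_cast this
  refine ⟨q, fun z => (hqa z).differentiableAt, fun z => ?_⟩
  have h1 : q =ᶠ[nhdsWithin z {z}ᶜ] f * g⁻¹ :=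
    hm.toMeromorphicNFOn_eq_self_on_nhdsNE (Set.mem_univ z)
  have h2 : ∀ᶠ w in nhdsWithin z {z}ᶜ, g w ≠ 0 := by
    rcases (hg.analyticAt z).eventually_eq_zero_or_eventually_ne_zero with h | h
    · exact absurd (analyticOrderAt_eq_top.mpr h) (hg0 z)
    · exact h
  have h3 : f =ᶠ[nhdsWithin z {z}ᶜ] g * q := by
    filter_upwards [h1, h2] with w hw1 hw2
    rw [Pi.mul_apply, hw1, Pi.mul_apply, Pi.inv_apply]
    field_simp
  exact ((ContinuousAt.eventuallyEq_nhds_iff_eventuallyEq_nhdsNE hf.continuous.continuousAt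
    (hg.continuous.continuousAt.mul (hqa z).continuousAt)).mp h3).eq_of_nhds

/-- An entire function of polynomial growth is a polynomial. -/
lemma exists_polynomial_of_norm_le {h : ℂ → ℂ} (hh : Differentiable ℂ h) {C : ℝ} {M : ℕ}
    (hC : ∀ z, ‖h z‖ ≤ C * (1 + ‖z‖) ^ M) : ∃ P : Polynomial ℂ, ∀ z, h z = P.eval z := by
  have hC0 : 0 ≤ C := by simpa using (norm_nonneg _).trans (hC 0)
  -- Cauchy's estimate on the circle of radius `R ≥ 1`, where `1 + R ≤ 2 * R`, as `R → ∞`.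
  have hzero : ∀ n, M < n → iteratedDeriv n h 0 = 0 := by
    intro n hn
    have hb : ∀ R : ℝ, 1 ≤ R → ‖iteratedDeriv n h 0‖ ≤ n.factorial * C * 2 ^ M / R := by
      intro R hR
      have hR0 : 0 < R := by linarith
      have h1 := Complex.norm_iteratedDeriv_le_of_forall_mem_sphere_norm_le n hR0
        (hh.diffContOnCl (s := Metric.ball 0 R)) (C := C * (2 * R) ^ M) fun z hz => by
          have hz : ‖z‖ = R := by simpa using hz
          refine (hC z).trans ?_
          rw [hz]
          gcongr
          linarith
      refine h1.trans ?_
      rw [div_le_div_iff₀ (by positivity) hR0, mul_pow]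
      have h2 : R ^ M * R ≤ R ^ n := by
        rw [← pow_succ]
        exact pow_le_pow_right₀ hR hn
      calc n.factorial * (C * (2 ^ M * R ^ M)) * R
          = n.factorial * C * 2 ^ M * (R ^ M * R) := by ring
        _ ≤ n.factorial * C * 2 ^ M * R ^ n := by gcongr
    have hlim : Filter.Tendsto (fun R : ℝ => n.factorial * C * 2 ^ M / R) Filter.atTop (nhds 0) :=
      Filter.Tendsto.const_div_atTop Filter.tendsto_id _
    have := ge_of_tendsto hlim ((Filter.eventually_ge_atTop 1).mono hb)
    exact norm_le_zero_iff.mp this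
  refine ⟨∑ n ∈ Finset.range (M + 1),
    Polynomial.C ((n.factorial : ℂ)⁻¹ * iteratedDeriv n h 0) * Polynomial.X ^ n, fun z => ?_⟩
  rw [← Complex.taylorSeries_eq_of_entire' 0 z hh, tsum_eq_sum (s := Finset.range (M + 1))]
  · simp [Polynomial.eval_finsetSum]
  · intro n hn
    rw [hzero n (by simpa using hn)]
    simp

lemma Polynomial.exists_norm_eval_le (P : Polynomial ℂ) {d : ℕ} (hd : P.natDegree ≤ d) :
    ∃ C > 0, ∀ z, ‖P.eval z‖ ≤ C * (1 + ‖z‖) ^ d := by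
  refine ⟨∑ i ∈ Finset.range (d + 1), ‖P.coeff i‖ + 1,
    add_pos_of_nonneg_of_pos (Finset.sum_nonneg fun _ _ => norm_nonneg _) one_pos, fun z => ?_⟩
  have h1 : (1 : ℝ) ≤ 1 + ‖z‖ := by linarith [norm_nonneg z]
  rw [Polynomial.eval_eq_sum_range' (Nat.lt_succ_of_le hd)]
  calc ‖∑ i ∈ Finset.range (d + 1), P.coeff i * z ^ i‖
      ≤ ∑ i ∈ Finset.range (d + 1), ‖P.coeff i * z ^ i‖ := norm_sum_le _ _
    _ ≤ ∑ i ∈ Finset.range (d + 1), ‖P.coeff i‖ * (1 + ‖z‖) ^ d := by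
        refine Finset.sum_le_sum fun i hi => ?_
        rw [norm_mul, norm_pow]
        gcongr ‖P.coeff i‖ * ?_
        calc ‖z‖ ^ i ≤ (1 + ‖z‖) ^ i := by gcongr; linarith
          _ ≤ (1 + ‖z‖) ^ d := pow_le_pow_right₀ h1 (by simpa [Nat.lt_succ_iff] using hi)
    _ = (∑ i ∈ Finset.range (d + 1), ‖P.coeff i‖) * (1 + ‖z‖) ^ d := by rw [Finset.sum_mul]
    _ ≤ (∑ i ∈ Finset.range (d + 1), ‖P.coeff i‖ + 1) * (1 + ‖z‖) ^ d := by
        gcongr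
        linarith

/-- Beyond `R` the lower-order terms are at most half of the leading one; replacing `‖z‖` by `1 +
‖z‖` costs a factor `2 ^ natDegree`. -/
lemma Polynomial.exists_le_norm_eval {P : Polynomial ℂ} (hP : P ≠ 0) :
    ∃ c > 0, ∃ R > 0, ∀ z : ℂ, R ≤ ‖z‖ → c * (1 + ‖z‖) ^ P.natDegree ≤ ‖P.eval z‖ := by
  have ha : 0 < ‖P.leadingCoeff‖ := norm_pos_iff.mpr (Polynomial.leadingCoeff_ne_zero.mpr hP)
  rcases Nat.eq_zero_or_pos P.natDegree with hd | hd
  · refine ⟨‖P.leadingCoeff‖, ha, 1, one_pos, fun z _ => ?_⟩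
    rw [Polynomial.eq_C_of_natDegree_eq_zero hd]
    simp
  obtain ⟨e, he⟩ := Nat.exists_eq_succ_of_ne_zero hd.ne'
  obtain ⟨C, hC, hQ⟩ := P.eraseLead.exists_norm_eval_le (d := e) (by
    have := P.eraseLead_natDegree_le
    omega)
  set A := ‖P.leadingCoeff‖
  refine ⟨A / 2 / 2 ^ P.natDegree, by positivity, 1 + 2 * C * 2 ^ e / A, by positivity,
    fun z hz => ?_⟩
  have hpos : 0 ≤ 2 * C * 2 ^ e / A := by positivity
  have hz1 : 1 ≤ ‖z‖ := by linarith
  have h1 : P.eval z = P.eraseLead.eval z + P.leadingCoeff * z ^ P.natDegree := by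
    have := congrArg (Polynomial.eval z) P.eraseLead_add_C_mul_X_pow
    simp only [Polynomial.eval_add, Polynomial.eval_mul, Polynomial.eval_C, Polynomial.eval_pow,
      Polynomial.eval_X] at this
    exact this.symm
  have h2 : A * ‖z‖ ^ P.natDegree - ‖P.eraseLead.eval z‖ ≤ ‖P.eval z‖ := by
    rw [h1]
    have := norm_sub_le (P.eraseLead.eval z + P.leadingCoeff * z ^ P.natDegree)
      (P.eraseLead.eval z)
    rw [add_sub_cancel_left, norm_mul, norm_pow] at this
    linarith
  have h3 : ‖P.eraseLead.eval z‖ ≤ A / 2 * ‖z‖ ^ P.natDegree := by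
    refine (hQ z).trans ?_
    have h4 : 2 * C * 2 ^ e / A ≤ ‖z‖ := by linarith
    rw [div_le_iff₀ ha] at h4
    calc C * (1 + ‖z‖) ^ e ≤ C * (2 * ‖z‖) ^ e := by gcongr; linarith
      _ = (2 * C * 2 ^ e) / 2 * ‖z‖ ^ e := by rw [mul_pow]; ring
      _ ≤ ‖z‖ * A / 2 * ‖z‖ ^ e := by gcongr
      _ = A / 2 * ‖z‖ ^ P.natDegree := by rw [he, pow_succ]; ring
  calc A / 2 / 2 ^ P.natDegree * (1 + ‖z‖) ^ P.natDegree
      ≤ A / 2 / 2 ^ P.natDegree * (2 * ‖z‖) ^ P.natDegree := by gcongr; linarith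
    _ = A / 2 * ‖z‖ ^ P.natDegree := by rw [mul_pow]; field_simp
    _ ≤ ‖P.eval z‖ := by linarith

end EntireFunctions

/-! ### Sub-mean value inequalities. -/

section MeanValue

open Real in
-- Jensen's formula, in which zeros inside the disc contribute nonnegatively.
lemma log_norm_le_circleAverage {F : ℂ → ℂ} (hF : Differentiable ℂ F) {c : ℂ} (hc : F c ≠ 0)
    {r : ℝ} (hr : 0 < r) : Real.log ‖F c‖ ≤ circleAverage (fun z => Real.log ‖F z‖) c r := by
  have hA : AnalyticOnNhd ℂ F (Metric.closedBall c |r|) := fun z _ => hF.analyticAt z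
  rw [hA.circleAverage_log_norm hr.ne' hc]
  refine le_add_of_nonneg_left (finsum_nonneg fun u => ?_)
  by_cases hu : u ∈ Metric.closedBall c |r|
  · refine mul_nonneg (mod_cast MeromorphicOn.AnalyticOnNhd.divisor_nonneg hA u) ?_
    by_cases huc : c = u
    · simp [huc]
    · apply Real.log_nonneg
      have h1 : 0 < ‖c - u‖ := norm_pos_iff.mpr (sub_ne_zero.mpr huc)
      rw [← div_eq_mul_inv, one_le_div h1, ← dist_eq_norm, dist_comm]
      simpa [abs_of_pos hr] using hu
  · rw [Function.locallyFinsuppWithin.apply_eq_zero_of_notMem _ hu]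
    simp

open Real in
/-- Sub-mean value property of `|F|^p` on circles. -/
lemma norm_rpow_le_circleAverage {F : ℂ → ℂ} (hF : Differentiable ℂ F) {p : ℝ} (hp : 0 < p)
    (c : ℂ) {r : ℝ} (hr : 0 < r) :
    ‖F c‖ ^ p ≤ circleAverage (fun z => ‖F z‖ ^ p) c r := by
  have hcont : Continuous fun z => ‖F z‖ ^ p :=
    hF.continuous.norm.rpow_const fun _ => Or.inr hp.le
  have hI : CircleIntegrable (fun z => ‖F z‖ ^ p) c r := hcont.continuousOn.circleIntegrable'
  have h0 : 0 ≤ circleAverage (fun z => ‖F z‖ ^ p) c r := by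
    rw [← circleAverage_const (0 : ℝ) c r]
    exact circleAverage_mono (circleIntegrable_const _ _ _) hI fun z _ => by positivity
  by_cases hc : F c = 0
  · rw [hc, norm_zero, Real.zero_rpow hp.ne']
    exact h0
  -- For `A` above the average, `log t ≤ t - 1` at `t = |F| ^ p / A` gives `p log |F| ≤ |F| ^ p / A
  -- + log A - 1`. Averaging bounds the mean of the left side by `log A`, and Jensen's inequality
  -- concludes.
  refine le_of_forall_gt_imp_ge_of_dense fun A hA => ?_
  have hA0 : 0 < A := h0.trans_lt hA
  have hpos : 0 < ‖F c‖ := norm_pos_iff.mpr hc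
  set f₁ : ℂ → ℝ := fun z => p * Real.log ‖F z‖ with hf₁
  -- As `Real.log 0 = 0`, the pointwise inequality may fail at zeros of `F`; the value there is
  -- altered on a discrete set, without effect on averages.
  set f₂ : ℂ → ℝ := fun z => if F z = 0 then Real.log A - 1 else p * Real.log ‖F z‖ with hf₂
  set f₃ : ℂ → ℝ := fun z => A⁻¹ * ‖F z‖ ^ p + (Real.log A - 1) with hf₃
  have hcod : f₁ =ᶠ[Filter.codiscreteWithin (Metric.sphere c |r|)] f₂ := by
    have hF' : AnalyticOnNhd ℂ F Set.univ := fun z _ => hF.analyticAt z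
    have h1 := hF'.preimage_zero_mem_codiscrete hc
    have h2 := Filter.codiscreteWithin_mono (Set.subset_univ (Metric.sphere c |r|)) h1
    filter_upwards [h2] with z hz
    have hz : F z ≠ 0 := by simpa using hz
    simp [hf₁, hf₂, hz]
  have hlogI : CircleIntegrable (fun z => Real.log ‖F z‖) c r :=
    MeromorphicOn.circleIntegrable_log_norm fun z _ => (hF.analyticAt z).meromorphicAt
  have hI₁ : CircleIntegrable f₁ c r := hlogI.const_fun_smul (a := p)
  have hI₂ : CircleIntegrable f₂ c r := hI₁.congr_codiscreteWithin hcod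
  have hI₃' : CircleIntegrable (fun z => A⁻¹ * ‖F z‖ ^ p) c r := hI.const_fun_smul (a := A⁻¹)
  have hI₃ : CircleIntegrable f₃ c r := hI₃'.add (circleIntegrable_const _ _ _)
  have hle : circleAverage f₂ c r ≤ circleAverage f₃ c r := by
    refine circleAverage_mono hI₂ hI₃ fun z _ => ?_
    simp only [hf₂, hf₃]
    split_ifs with hz
    · have : 0 ≤ A⁻¹ * ‖F z‖ ^ p := by positivity
      linarith
    · have hz : 0 < ‖F z‖ := norm_pos_iff.mpr hz
      have h1 := Real.log_le_sub_one_of_pos (show 0 < A⁻¹ * ‖F z‖ ^ p by positivity)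
      rw [Real.log_mul (by positivity) (by positivity), Real.log_inv, Real.log_rpow hz] at h1
      linarith
  have h3 : circleAverage f₃ c r = A⁻¹ * circleAverage (fun z => ‖F z‖ ^ p) c r
      + (Real.log A - 1) := by
    rw [hf₃, circleAverage_fun_add hI₃' (circleIntegrable_const _ _ _), circleAverage_const]
    congr 1
    exact circleAverage_fun_smul (a := A⁻¹)
  have h4 : circleAverage f₁ c r = p * circleAverage (fun z => Real.log ‖F z‖) c r :=
    circleAverage_fun_smul (a := p)
  have h5 : A⁻¹ * circleAverage (fun z => ‖F z‖ ^ p) c r ≤ 1 := by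
    rw [inv_mul_le_iff₀ hA0, mul_one]
    exact hA.le
  have h6 := mul_le_mul_of_nonneg_left (log_norm_le_circleAverage hF hc hr) hp.le
  rw [← h4, circleAverage_congr_codiscreteWithin hcod hr.ne'] at h6
  rw [← Real.log_le_log_iff (by positivity) hA0, Real.log_rpow hpos]
  linarith

/-- Polar coordinates on the annulus `1 / 2 < r < 1`: the Jacobian is at least `1 / 2` and the width
is `1 / 2`, whence the constant `4`. -/
lemma le_lintegral_ball_of_le_circle {G : ℂ → ℝ≥0∞} (hG : Measurable G) {A : ℝ≥0∞}
    (h : ∀ r : ℝ, 0 < r → A ≤ ∫⁻ θ in Set.Ioo (-Real.pi) Real.pi,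
      G (r * (Real.cos θ + Real.sin θ * Complex.I))) :
    A ≤ 4 * ∫⁻ z in Metric.ball (0 : ℂ) 1, G z := by
  rw [← lintegral_indicator measurableSet_ball, ← Complex.lintegral_comp_polarCoord_symm]
  have hm : Measurable ((Metric.ball (0 : ℂ) 1).indicator G) := hG.indicator measurableSet_ball
  rw [polarCoord_target, Measure.volume_eq_prod, setLIntegral_prod]
  · calc A = 4 * ∫⁻ _ in Set.Ioo (1 / 2 : ℝ) 1, ENNReal.ofReal (1 / 2) * A := by
          rw [setLIntegral_const, Real.volume_Ioo, mul_right_comm, ← ENNReal.ofReal_mul (by simp),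
            ← mul_assoc, ← ENNReal.ofReal_ofNat, ← ENNReal.ofReal_mul (by simp)]
          norm_num
      _ ≤ 4 * ∫⁻ r in Set.Ioo (1 / 2 : ℝ) 1, ∫⁻ θ in Set.Ioo (-Real.pi) Real.pi,
          ENNReal.ofReal r • (Metric.ball (0 : ℂ) 1).indicator G
            (Complex.polarCoord.symm (r, θ)) := by
          gcongr 4 * ?_
          refine setLIntegral_mono' measurableSet_Ioo fun r hr => ?_
          have hr0 : 0 < r := by linarith [hr.1]
          simp_rw [smul_eq_mul]
          rw [lintegral_const_mul]
          · gcongr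
            · exact hr.1.le
            · refine (h r hr0).trans (lintegral_mono fun θ => ?_)
              rw [Set.indicator_of_mem]
              · simp
              · rw [mem_ball_zero_iff, Complex.norm_polarCoord_symm, abs_of_pos hr0]
                exact hr.2
          · refine hm.comp ?_
            simp only [Complex.polarCoord_symm_apply]
            fun_prop
      _ ≤ _ := by
          gcongr 4 * ?_
          refine lintegral_mono_set fun r hr => ?_
          exact lt_trans (by norm_num) hr.1
  · simp_rw [smul_eq_mul]
    refine (Measurable.mul ?_ (hm.comp ?_)).aemeasurable
    · fun_prop
    · have : Continuous fun p : ℝ × ℝ => Complex.polarCoord.symm p := by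
        simp only [Complex.polarCoord_symm_apply]
        fun_prop
      exact this.measurable

open Real in
/-- Sub-mean value property of `|F|^p` on a disc, with a constant. -/
lemma ofReal_norm_rpow_le_lintegral {F : ℂ → ℂ} (hF : Differentiable ℂ F) {p : ℝ} (hp : 0 < p) :
    ENNReal.ofReal (‖F 0‖ ^ p) ≤
      4 * ∫⁻ z in Metric.ball (0 : ℂ) 1, ENNReal.ofReal (‖F z‖ ^ p) := by
  have hcont : Continuous fun z => ‖F z‖ ^ p :=
    hF.continuous.norm.rpow_const fun _ => Or.inr hp.le
  refine le_lintegral_ball_of_le_circle hcont.measurable.ennreal_ofReal fun r hr => ?_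
  have h1 := norm_rpow_le_circleAverage hF hp 0 hr
  rw [circleAverage_eq_integral_add (-π),
    intervalIntegral.integral_comp_add_right (fun θ => ‖F (circleMap 0 r θ)‖ ^ p),
    show (0 + -π : ℝ) = -π by ring, show (2 * π + -π : ℝ) = π by ring, smul_eq_mul] at h1
  set J := ∫ θ in (-π)..π, ‖F (circleMap 0 r θ)‖ ^ p with hJ
  have hJ0 : 0 ≤ J := intervalIntegral.integral_nonneg (by linarith [pi_pos]) fun θ _ => by
    positivity
  have h2 : ‖F 0‖ ^ p ≤ J := h1.trans (mul_le_of_le_one_left hJ0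
    (inv_le_one_of_one_le₀ (by linarith [Real.pi_gt_three])))
  refine (ENNReal.ofReal_le_ofReal h2).trans (le_of_eq ?_)
  rw [hJ, intervalIntegral.integral_of_le (by linarith [pi_pos]),
    ofReal_integral_eq_lintegral_ofReal]
  · rw [restrict_Ioo_eq_restrict_Ioc]
    refine lintegral_congr fun θ => ?_
    rw [circleMap_zero, Complex.exp_mul_I]
    push_cast
    rfl
  · have : Continuous fun θ => ‖F (circleMap 0 r θ)‖ ^ p := hcont.comp (continuous_circleMap 0 r)
    exact this.integrableOn_Ioc
  · exact Filter.Eventually.of_forall fun θ => by positivity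

end MeanValue

/-! ### Powers of `1 + ‖z‖` in `L^p` and the exponent `N`. -/

section Integrability

variable {p : ℝ≥0∞}

/-- Only the behaviour near infinity matters: on a disc the continuous function is bounded. -/
lemma memLp_of_continuous_of_norm_le {E F : Type*} [NormedAddCommGroup E] [NormedAddCommGroup F]
    [SecondCountableTopologyEither ℂ E] {g : ℂ → E} (hg : Continuous g) {f : ℂ → F}
    (hf : MemLp f p volume) {C R : ℝ} (h : ∀ z, R ≤ ‖z‖ → ‖g z‖ ≤ C * ‖f z‖) :
    MemLp g p volume := by
  obtain ⟨K, hK⟩ := (isCompact_closedBall (0 : ℂ) R).exists_bound_of_continuousOn hg.continuousOn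
  have h1 : MemLp (fun z => C * ‖f z‖) p volume := hf.norm.const_mul C
  have h2 : MemLp ((Metric.closedBall (0 : ℂ) R).indicator fun _ => K) p volume :=
    memLp_indicator_const p measurableSet_closedBall K
      (Or.inr (measure_closedBall_lt_top).ne)
  refine (h1.norm.add h2.norm).mono' hg.aestronglyMeasurable
    (Filter.Eventually.of_forall fun z => ?_)
  simp only [Pi.add_apply]
  by_cases hz : ‖z‖ ≤ R
  · have hz : z ∈ Metric.closedBall (0 : ℂ) R := by simpa using hz
    rw [Set.indicator_of_mem hz]
    exact (hK z hz).trans ((le_abs_self K).trans (le_add_of_nonneg_left (norm_nonneg _)))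
  · exact (h z (by linarith)).trans ((le_abs_self _).trans (le_add_of_nonneg_right (norm_nonneg _)))

lemma continuous_one_add_norm_rpow (s : ℝ) : Continuous fun z : ℂ => (1 + ‖z‖) ^ s :=
  (continuous_const.add continuous_norm).rpow_const fun z =>
    Or.inl (show (0 : ℝ) < 1 + ‖z‖ by positivity).ne'

lemma memLp_one_add_norm_rpow_iff_integrable (hp0 : p ≠ 0) (hp : p ≠ ⊤) (s : ℝ) :
    MemLp (fun z : ℂ => (1 + ‖z‖) ^ s) p volume ↔
      Integrable fun z : ℂ => (1 + ‖z‖) ^ (s * p.toReal) := by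
  rw [← integrable_norm_rpow_iff (continuous_one_add_norm_rpow s).aestronglyMeasurable hp0 hp]
  refine iff_of_eq (congrArg (Integrable · volume) (funext fun z => ?_))
  rw [Real.norm_of_nonneg (by positivity), ← Real.rpow_mul (by positivity)]

/-- In polar coordinates the radial integrand `x * (1 + x) ^ s` is at least `1 / (4 * x)` for `x >
1`. -/
lemma not_integrable_one_add_norm_rpow {s : ℝ} (hs : -2 ≤ s) :
    ¬ Integrable fun z : ℂ => (1 + ‖z‖) ^ s := by
  intro h
  have h1 := (integrable_fun_norm_addHaar (volume : Measure ℂ)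
    (f := fun x : ℝ => (1 + x) ^ s)).mp h
  rw [Complex.finrank_real_complex] at h1
  have h2 : IntegrableOn (fun x : ℝ => x⁻¹) (Set.Ioi 1) := by
    have h3 := (h1.mono_set (Set.Ioi_subset_Ioi zero_le_one)).const_mul 4
    refine Integrable.mono' h3 measurable_inv.aestronglyMeasurable ?_
    refine (ae_restrict_iff' measurableSet_Ioi).mpr (Filter.Eventually.of_forall fun x hx => ?_)
    have hx : (1 : ℝ) < x := hx
    have hx0 : 0 < x := by linarith
    rw [Real.norm_of_nonneg (by positivity), smul_eq_mul]
    have h4 : (2 * x) ^ (-2 : ℝ) ≤ (1 + x) ^ s :=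
      calc (2 * x) ^ (-2 : ℝ) ≤ (1 + x) ^ (-2 : ℝ) :=
            Real.rpow_le_rpow_of_nonpos (by positivity) (by linarith) (by norm_num)
        _ ≤ (1 + x) ^ s := Real.rpow_le_rpow_of_exponent_le (by linarith) hs
    calc x⁻¹ = 4 * (x ^ (2 - 1) * (2 * x) ^ (-2 : ℝ)) := by
          rw [Real.rpow_neg (by positivity)]
          norm_cast
          field_simp
          ring
      _ ≤ 4 * (x ^ (2 - 1) * (1 + x) ^ s) := by gcongr
  exact not_integrableOn_Ioi_inv h2

lemma criticalExponent_spec (hp0 : 0 < p) (hp : p ≠ ⊤) :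
    0 < criticalExponent p ∧ 2 < (criticalExponent p : ℝ) * p.toReal ∧
      ((criticalExponent p : ℝ) - 1) * p.toReal ≤ 2 := by
  have hpr : 0 < p.toReal := ENNReal.toReal_pos hp0.ne' hp
  have key : ∀ n : ℕ, 2 < (n : ℝ≥0∞) * p ↔ 2 < (n : ℝ) * p.toReal := by
    intro n
    conv_lhs => rw [← ENNReal.ofReal_toReal hp, ← ENNReal.ofReal_natCast,
      ← ENNReal.ofReal_mul (by positivity), ← ENNReal.ofReal_ofNat]
    exact ENNReal.ofReal_lt_ofReal_iff_of_nonneg (by norm_num)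
  have hN : criticalExponent p = sInf {N : ℕ | 0 < N ∧ 2 < (N : ℝ≥0∞) * p} := if_neg hp
  have hne : {N : ℕ | 0 < N ∧ 2 < (N : ℝ≥0∞) * p}.Nonempty := by
    obtain ⟨n, hn⟩ := exists_nat_gt (2 / p.toReal)
    rw [div_lt_iff₀ hpr] at hn
    refine ⟨n, Nat.pos_of_ne_zero ?_, (key n).mpr hn⟩
    rintro rfl
    norm_num at hn
  have hmem := Nat.sInf_mem hne
  rw [← hN] at hmem
  refine ⟨hmem.1, (key _).mp hmem.2, ?_⟩
  -- Otherwise `N - 1` would be positive and admissible, against minimality; for `N = 1` the left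
  -- side is `0`.
  by_contra! h
  obtain ⟨m, hm⟩ := Nat.exists_eq_succ_of_ne_zero hmem.1.ne'
  rw [hm, Nat.succ_eq_add_one, Nat.cast_add_one, add_sub_cancel_right] at h
  have hm0 : 0 < m := by
    refine Nat.pos_of_ne_zero ?_
    rintro rfl
    norm_num at h
  have := Nat.sInf_le (s := {N : ℕ | 0 < N ∧ 2 < (N : ℝ≥0∞) * p}) ⟨hm0, (key m).mpr h⟩
  rw [← hN] at this
  omega

lemma criticalExponent_top : criticalExponent ⊤ = 0 := if_pos rfl

lemma memLp_one_add_norm_criticalExponent (hp0 : 0 < p) :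
    MemLp (fun z : ℂ => (1 + ‖z‖) ^ (-(criticalExponent p : ℝ))) p volume := by
  by_cases hp : p = ⊤
  · subst hp
    simp [criticalExponent_top, memLp_top_const]
  · rw [memLp_one_add_norm_rpow_iff_integrable hp0.ne' hp, neg_mul]
    refine integrable_one_add_norm ?_
    rw [Complex.finrank_real_complex]
    exact_mod_cast (criticalExponent_spec hp0 hp).2.1

/-- An essentially bounded continuous function is bounded. -/
lemma exists_norm_le_of_memLp_top {E : Type*} [NormedAddCommGroup E] {u : ℂ → E}
    (hu : Continuous u) (h : MemLp u ⊤ volume) : ∃ C, ∀ z, ‖u z‖ ≤ C := by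
  set C := (eLpNorm u ⊤ volume).toReal
  have hC : ∀ᵐ z, ‖u z‖ ≤ C := by
    filter_upwards [ae_le_eLpNormEssSup (f := u) (μ := volume)] with z hz
    rw [← eLpNorm_exponent_top] at hz
    rw [← toReal_enorm]
    exact ENNReal.toReal_mono h.2.ne hz
  refine ⟨C, fun z => ?_⟩
  -- The a.e. bound is recast as an a.e. equality of continuous functions, which holds everywhere.
  have h1 : (fun z => max ‖u z‖ C) =ᵐ[volume] fun _ => C := by
    filter_upwards [hC] with z hz
    exact max_eq_right hz
  have h2 := (Continuous.ae_eq_iff_eq volume (hu.norm.max continuous_const) continuous_const).mp h1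
  exact max_eq_right_iff.mp (congrFun h2 z)

/-- Sharpness of `N`: `(N - 1) * p ≤ 2` rules out integrability in the plane, and for `p = ∞` the
function is `1 + ‖z‖`. -/
lemma not_memLp_one_add_norm_criticalExponent (hp0 : 0 < p) :
    ¬ MemLp (fun z : ℂ => (1 + ‖z‖) ^ (1 - (criticalExponent p : ℝ))) p volume := by
  by_cases hp : p = ⊤
  · subst hp
    intro h
    obtain ⟨C, hC⟩ := exists_norm_le_of_memLp_top (continuous_one_add_norm_rpow _) h
    have h1 := hC (|C| : ℝ)
    rw [criticalExponent_top, Nat.cast_zero, sub_zero, Real.rpow_one,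
      Real.norm_of_nonneg (by positivity), Complex.norm_real, Real.norm_of_nonneg (abs_nonneg C)]
      at h1
    linarith [le_abs_self C]
  · rw [memLp_one_add_norm_rpow_iff_integrable hp0.ne' hp]
    refine not_integrable_one_add_norm_rpow ?_
    linarith [(criticalExponent_spec hp0 hp).2.2]

end Integrability

/-! ### Pointwise estimates in the Fock space. -/

section FockSpace

variable {α : ℝ} {p : ℝ≥0∞}

lemma norm_mul_gaussian (α : ℝ) (w z : ℂ) : ‖w * (Real.exp (-(α / 2) * ‖z‖ ^ 2) : ℂ)‖ =
    ‖w‖ * Real.exp (-(α / 2) * ‖z‖ ^ 2) := by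
  rw [norm_mul, Complex.norm_real, Real.norm_of_nonneg (Real.exp_pos _).le]

lemma continuous_mul_gaussian {f : ℂ → ℂ} (hf : Continuous f) (α : ℝ) :
    Continuous fun z : ℂ => f z * (Real.exp (-(α / 2) * ‖z‖ ^ 2) : ℂ) := by
  refine hf.mul (Complex.continuous_ofReal.comp ?_)
  fun_prop

lemma mem_fockSpace_of_norm_le (hp : 0 < p) {f : ℂ → ℂ} (hf : Differentiable ℂ f) {C R : ℝ}
    (h : ∀ z, R ≤ ‖z‖ → ‖f z‖ * Real.exp (-(α / 2) * ‖z‖ ^ 2) ≤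
      C * (1 + ‖z‖) ^ (-(criticalExponent p : ℝ))) : f ∈ fockSpace α p := by
  refine ⟨hf, memLp_of_continuous_of_norm_le (continuous_mul_gaussian hf.continuous α)
    (memLp_one_add_norm_criticalExponent hp) (C := C) (R := R) fun z hz => ?_⟩
  rw [norm_mul_gaussian, Real.norm_of_nonneg (by positivity)]
  exact h z hz

/-- Functions in the Fock space are dominated by the Gaussian. -/
lemma exists_norm_le_of_mem_fockSpace (hα : 0 < α) (hp : 0 < p) {f : ℂ → ℂ}
    (hf : f ∈ fockSpace α p) :
    ∃ C > 0, ∀ z, ‖f z‖ * Real.exp (-(α / 2) * ‖z‖ ^ 2) ≤ C := by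
  suffices h : ∃ C, ∀ z, ‖f z‖ * Real.exp (-(α / 2) * ‖z‖ ^ 2) ≤ C by
    obtain ⟨C, hC⟩ := h
    exact ⟨max C 1, by positivity, fun z => (hC z).trans (le_max_left _ _)⟩
  have hcont := continuous_mul_gaussian hf.1.continuous α
  by_cases hpt : p = ⊤
  · subst hpt
    obtain ⟨C, hC⟩ := exists_norm_le_of_memLp_top hcont hf.2
    refine ⟨C, fun z => ?_⟩
    rw [← norm_mul_gaussian]
    exact hC z
  set s := p.toReal with hs
  have hs0 : 0 < s := ENNReal.toReal_pos hp.ne' hpt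
  set u : ℂ → ℝ := fun z => ‖f z‖ * Real.exp (-(α / 2) * ‖z‖ ^ 2) with hu
  have hu0 : ∀ z, 0 ≤ u z := fun z => by positivity
  have hfin : ∫⁻ z, ENNReal.ofReal (u z ^ s) < ⊤ := by
    have h1 := (eLpNorm_lt_top_iff_lintegral_rpow_enorm_lt_top hp.ne' hpt).mp hf.2.2
    refine lt_of_eq_of_lt (lintegral_congr fun z => ?_) h1
    rw [← ofReal_norm, norm_mul_gaussian, ENNReal.ofReal_rpow_of_nonneg (hu0 z) hs0.le]
  set I := ∫⁻ z, ENNReal.ofReal (u z ^ s) with hI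
  have hbound : ∀ c, u c ^ s ≤ (4 * ENNReal.ofReal (Real.exp (s * (α / 2))) * I).toReal := by
    intro c
    -- The exponential absorbs the cross term of `‖w + c‖ ^ 2`, so on the unit disc `|F|` is the
    -- translated weighted modulus up to `exp (α / 2 * ‖c‖ ^ 2)`, which cancels later, and a bounded
    -- factor. The bound is thus uniform in `c`.
    set F : ℂ → ℂ := fun w => f (w + c) * Complex.exp (-(α * (starRingEnd ℂ) c) * w) with hF
    have hFd : Differentiable ℂ F := by
      refine (hf.1.comp (differentiable_id.add_const c)).mul ?_
      fun_prop
    have hFn : ∀ w, ‖F w‖ = u (w + c) * Real.exp (α / 2 * (‖c‖ ^ 2 + ‖w‖ ^ 2)) := by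
      intro w
      rw [hF, hu]
      simp only
      rw [norm_mul, Complex.norm_exp, mul_assoc, ← Real.exp_add]
      congr 2
      rw [← Complex.normSq_eq_norm_sq, ← Complex.normSq_eq_norm_sq, ← Complex.normSq_eq_norm_sq,
        Complex.normSq_apply, Complex.normSq_apply, Complex.normSq_apply]
      simp
      ring
    have h1 := ofReal_norm_rpow_le_lintegral hFd hs0
    have h2 : ∫⁻ z in Metric.ball (0 : ℂ) 1, ENNReal.ofReal (‖F z‖ ^ s) ≤
        ENNReal.ofReal (Real.exp (s * (α / 2 * (‖c‖ ^ 2 + 1)))) * I := by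
      have hI' : I = ∫⁻ z, ENNReal.ofReal (u (z + c) ^ s) :=
        (lintegral_add_right_eq_self (fun z => ENNReal.ofReal (u z ^ s)) c).symm
      rw [hI', ← lintegral_const_mul']
      · refine le_trans (setLIntegral_mono' measurableSet_ball fun w hw => ?_)
          (setLIntegral_le_lintegral _ _)
        rw [← ENNReal.ofReal_mul (Real.exp_pos _).le, hFn, Real.mul_rpow (hu0 _) (Real.exp_pos _).le,
          ← Real.exp_mul, mul_comm]
        refine ENNReal.ofReal_le_ofReal ?_
        have hw : ‖w‖ < 1 := by simpa using hw
        have := hu0 (w + c)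
        rw [mul_comm _ s]
        gcongr
        nlinarith [norm_nonneg w]
      · exact ENNReal.ofReal_ne_top
    have h3 : ‖F 0‖ ^ s = u c ^ s * Real.exp (s * (α / 2 * ‖c‖ ^ 2)) := by
      rw [hFn, Real.mul_rpow (hu0 _) (Real.exp_pos _).le, ← Real.exp_mul]
      simp only [zero_add, norm_zero]
      congr 2
      ring
    have h4 : Real.exp (s * (α / 2 * (‖c‖ ^ 2 + 1))) =
        Real.exp (s * (α / 2)) * Real.exp (s * (α / 2 * ‖c‖ ^ 2)) := by
      rw [← Real.exp_add]
      congr 1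
      ring
    have h5 := h1.trans (mul_le_mul_right h2 4)
    rw [h3, h4, ENNReal.ofReal_mul (by have := hu0 c; positivity),
      ENNReal.ofReal_mul (Real.exp_pos _).le] at h5
    have h6 : ENNReal.ofReal (u c ^ s) ≤ 4 * ENNReal.ofReal (Real.exp (s * (α / 2))) * I := by
      refine (ENNReal.mul_le_mul_iff_left (c := ENNReal.ofReal (Real.exp (s * (α / 2 * ‖c‖ ^ 2))))
        ?_ ENNReal.ofReal_ne_top).mp (h5.trans (le_of_eq (by ring)))
      exact (ENNReal.ofReal_pos.mpr (Real.exp_pos _)).ne'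
    refine (ENNReal.ofReal_le_iff_le_toReal ?_).mp h6
    exact ENNReal.mul_ne_top (ENNReal.mul_ne_top (by simp) ENNReal.ofReal_ne_top) hfin.ne
  refine ⟨((4 * ENNReal.ofReal (Real.exp (s * (α / 2))) * I).toReal) ^ s⁻¹, fun z => ?_⟩
  exact (Real.le_rpow_inv_iff_of_pos (hu0 z) ENNReal.toReal_nonneg hs0).mpr (hbound z)

end FockSpace

/-! ### Bounds for the periodic weight. -/

section LatticeGeometry

variable {α : ℝ}

/-- The weighted modulus `|σ_α(z)| exp(-α |z|² / 2)`, a function periodic with respect to the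
lattice. -/
noncomputable def sigmaWeight (α : ℝ) (z : ℂ) : ℝ :=
  ‖weierstrassSigma α z‖ * Real.exp (-(α / 2) * ‖z‖ ^ 2)

lemma sigmaWeight_add (hα : 0 < α) {l : ℂ} (hl : l ∈ squareLattice α) (z : ℂ) :
    sigmaWeight α (z + l) = sigmaWeight α z :=
  norm_weierstrassSigma_mul_exp_add hα hl z

lemma differentiable_weierstrassSigma (hα : 0 < α) : Differentiable ℂ (weierstrassSigma α) := by
  rw [weierstrassSigma_eq hα]
  exact PeriodPair.differentiable_sigma _

lemma weierstrassSigma_eq_zero_iff (hα : 0 < α) {z : ℂ} :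
    weierstrassSigma α z = 0 ↔ z ∈ squareLattice α := by
  rw [weierstrassSigma_eq hα, mem_squareLattice_iff hα, PeriodPair.sigma_eq_zero_iff]

lemma continuous_sigmaWeight (hα : 0 < α) : Continuous (sigmaWeight α) := by
  refine (differentiable_weierstrassSigma hα).continuous.norm.mul ?_
  fun_prop

lemma sigmaWeight_nonneg (α : ℝ) (z : ℂ) : 0 ≤ sigmaWeight α z := by
  unfold sigmaWeight
  positivity

lemma sigmaWeight_pos (hα : 0 < α) {z : ℂ} (hz : z ∉ squareLattice α) : 0 < sigmaWeight α z := by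
  have : 0 < ‖weierstrassSigma α z‖ :=
    norm_pos_iff.mpr fun h => hz ((weierstrassSigma_eq_zero_iff hα).mp h)
  unfold sigmaWeight
  positivity

/-- The mesh of the lattice `Λ_α`. -/
noncomputable def latticeMesh (α : ℝ) : ℝ := Real.sqrt (Real.pi / α)

lemma latticeMesh_pos (hα : 0 < α) : 0 < latticeMesh α := Real.sqrt_pos.mpr (by positivity)

/-- The constant `3 / 4` exceeds `√2 / 2`, half the diagonal of a cell, and is less than `1`, so
circles of this radius around lattice points avoid the lattice. -/
lemma exists_norm_sub_le_latticeMesh (hα : 0 < α) (z : ℂ) :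
    ∃ l ∈ squareLattice α, ‖z - l‖ ≤ 3 / 4 * latticeMesh α := by
  have ha := latticeMesh_pos hα
  set a := latticeMesh α with ha'
  refine ⟨latticePoint α (round (z.re / a), round (z.im / a)), ⟨_, rfl⟩, ?_⟩
  have hre := abs_sub_round (z.re / a)
  have him := abs_sub_round (z.im / a)
  have h1 : ‖z - latticePoint α (round (z.re / a), round (z.im / a))‖ ^ 2 =
      a ^ 2 * ((z.re / a - round (z.re / a)) ^ 2 + (z.im / a - round (z.im / a)) ^ 2) := by
    rw [← Complex.normSq_eq_norm_sq, Complex.normSq_apply, latticePoint,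
      show Real.sqrt (Real.pi / α) = a from rfl]
    simp
    field_simp
  refine abs_le_of_sq_le_sq' ?_ (by positivity) |>.2
  rw [h1, mul_pow, mul_comm]
  have h2 : (z.re / a - round (z.re / a)) ^ 2 ≤ (1 / 2) ^ 2 :=
    sq_le_sq' (abs_le.mp hre).1 (abs_le.mp hre).2
  have h3 : (z.im / a - round (z.im / a)) ^ 2 ≤ (1 / 2) ^ 2 :=
    sq_le_sq' (abs_le.mp him).1 (abs_le.mp him).2
  gcongr
  linarith

lemma notMem_squareLattice_of_norm (hα : 0 < α) {z : ℂ} (h0 : 0 < ‖z‖) (h : ‖z‖ < latticeMesh α) :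
    z ∉ squareLattice α := by
  intro hz
  have := PeriodPair.eq_zero_of_mem_square_lattice (latticeMesh_pos hα)
    ((mem_squareLattice_iff hα).mp hz) ((Complex.abs_re_le_norm z).trans_lt h)
    ((Complex.abs_im_le_norm z).trans_lt h)
  rw [this, norm_zero] at h0
  exact lt_irrefl _ h0

lemma exists_le_sigmaWeight (hα : 0 < α) : ∃ c > 0, ∀ l ∈ squareLattice α,
    ∀ z, ‖z - l‖ = 3 / 4 * latticeMesh α → c ≤ sigmaWeight α z := by
  have ha := latticeMesh_pos hα
  have hne : (Metric.sphere (0 : ℂ) (3 / 4 * latticeMesh α)).Nonempty :=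
    NormedSpace.sphere_nonempty.mpr (by positivity)
  obtain ⟨w, hw, hmin⟩ := (isCompact_sphere (0 : ℂ) (3 / 4 * latticeMesh α)).exists_isMinOn hne
    (continuous_sigmaWeight hα).continuousOn
  have hw : ‖w‖ = 3 / 4 * latticeMesh α := by simpa using hw
  refine ⟨sigmaWeight α w, sigmaWeight_pos hα (notMem_squareLattice_of_norm hα
    (by rw [hw]; positivity) (by linarith)), fun l hl z hz => ?_⟩
  rw [← sub_add_cancel z l, sigmaWeight_add hα hl]
  exact hmin (by simpa using hz)

lemma exists_sigmaWeight_le (hα : 0 < α) : ∃ C > 0, ∀ z, sigmaWeight α z ≤ C := by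
  obtain ⟨C, hC⟩ :=
    (isCompact_closedBall (0 : ℂ) (3 / 4 * latticeMesh α)).exists_bound_of_continuousOn
    (continuous_sigmaWeight hα).continuousOn
  refine ⟨max C 1, by positivity, fun z => ?_⟩
  obtain ⟨l, hl, hz⟩ := exists_norm_sub_le_latticeMesh hα z
  rw [← sub_add_cancel z l, sigmaWeight_add hα hl]
  exact (le_abs_self _).trans ((hC _ (by simpa using hz)).trans (le_max_left _ _))

/-- The weight itself vanishes on the lattice. A shift by half the mesh separates the zeros, so the
periodic sum is positive and attains a positive minimum. -/
lemma exists_le_sigmaWeight_add_sigmaWeight (hα : 0 < α) :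
    ∃ t : ℂ, ∃ c > 0, ∀ z, c ≤ sigmaWeight α z + sigmaWeight α (z + t) := by
  have ha := latticeMesh_pos hα
  set t : ℂ := ((latticeMesh α / 2 : ℝ) : ℂ) with ht
  have htn : ‖t‖ = latticeMesh α / 2 := by
    rw [ht, Complex.norm_real, Real.norm_of_nonneg (by positivity)]
  have htl : t ∉ squareLattice α :=
    notMem_squareLattice_of_norm hα (by rw [htn]; positivity) (by rw [htn]; linarith)
  have hcont : Continuous fun z => sigmaWeight α z + sigmaWeight α (z + t) :=
    (continuous_sigmaWeight hα).add ((continuous_sigmaWeight hα).comp (continuous_add_const t))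
  have hpos : ∀ z, 0 < sigmaWeight α z + sigmaWeight α (z + t) := by
    intro z
    by_cases hz : z ∈ squareLattice α
    · refine add_pos_of_nonneg_of_pos (sigmaWeight_nonneg _ _) ?_
      rw [add_comm, sigmaWeight_add hα hz]
      exact sigmaWeight_pos hα htl
    · exact add_pos_of_pos_of_nonneg (sigmaWeight_pos hα hz) (sigmaWeight_nonneg _ _)
  obtain ⟨w, hw, hmin⟩ := (isCompact_closedBall (0 : ℂ) (3 / 4 * latticeMesh α)).exists_isMinOn
    (Metric.nonempty_closedBall.mpr (by positivity)) hcont.continuousOn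
  refine ⟨t, _, hpos w, fun z => ?_⟩
  obtain ⟨l, hl, hz⟩ := exists_norm_sub_le_latticeMesh hα z
  have h1 := hmin (a := z - l) (by simpa using hz)
  simp only [Set.mem_ofPred_eq] at h1
  rw [← sigmaWeight_add hα hl (z - l), ← sigmaWeight_add hα hl (z - l + t),
    sub_add_cancel, add_right_comm, sub_add_cancel] at h1
  exact h1

end LatticeGeometry

/-! ### A criterion for not lying in the Fock space. -/

section NonMembership

variable {α : ℝ} {p : ℝ≥0∞}

/-- Peetre's inequality: a translation costs only a constant factor. -/
lemma one_add_norm_rpow_le (s : ℝ) (z t : ℂ) :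
    (1 + ‖z‖) ^ s ≤ (1 + ‖t‖) ^ |s| * (1 + ‖z + t‖) ^ s := by
  have key : ∀ z t : ℂ, 1 + ‖z‖ ≤ (1 + ‖t‖) * (1 + ‖z + t‖) := by
    intro z t
    have h := norm_sub_le (z + t) t
    rw [add_sub_cancel_right] at h
    nlinarith [norm_nonneg t, norm_nonneg (z + t), mul_nonneg (norm_nonneg t) (norm_nonneg (z + t))]
  rcases le_or_gt 0 s with hs | hs
  · rw [abs_of_nonneg hs, ← Real.mul_rpow (by positivity) (by positivity)]
    exact Real.rpow_le_rpow (by positivity) (key z t) hs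
  · have h := key (z + t) (-t)
    rw [add_neg_cancel_right, norm_neg] at h
    have h1 := Real.rpow_le_rpow_of_nonpos (by positivity) h hs.le
    rw [Real.mul_rpow (by positivity) (by positivity)] at h1
    rw [abs_of_neg hs, Real.rpow_neg (by positivity), ← div_eq_inv_mul,
      le_div_iff₀ (by positivity), mul_comm]
    exact h1

/-- A function of size at least `|σ_α(z)| |z|^(1 - N)` near infinity is not in the Fock space. -/
lemma notMem_fockSpace_of_le (hα : 0 < α) (hp : 0 < p) {f : ℂ → ℂ} {C R : ℝ}
    (h : ∀ z, R ≤ ‖z‖ → (1 + ‖z‖) ^ (1 - (criticalExponent p : ℝ)) * sigmaWeight α z ≤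
      C * (‖f z‖ * Real.exp (-(α / 2) * ‖z‖ ^ 2))) : f ∉ fockSpace α p := by
  intro hf
  set s : ℝ := 1 - (criticalExponent p : ℝ) with hs
  set G : ℂ → ℝ := fun z => (1 + ‖z‖) ^ s * sigmaWeight α z with hG
  have hGc : Continuous G := (continuous_one_add_norm_rpow s).mul (continuous_sigmaWeight hα)
  have hG0 : ∀ z, 0 ≤ G z := fun z => mul_nonneg (by positivity) (sigmaWeight_nonneg _ _)
  have hGm : MemLp G p volume := by
    refine memLp_of_continuous_of_norm_le hGc hf.2 (C := C) (R := R) fun z hz => ?_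
    rw [norm_mul_gaussian, Real.norm_of_nonneg (hG0 z)]
    exact h z hz
  -- Adding a translate of `G` removes its zeros: the sum dominates `(1 + ‖z‖) ^ (1 - N)`, which is
  -- not in `L^p`.
  obtain ⟨t, c, hc, hct⟩ := exists_le_sigmaWeight_add_sigmaWeight hα
  have hGt : MemLp (fun z => G (z + t)) p volume :=
    hGm.comp_measurePreserving (measurePreserving_add_right volume t)
  have hsum := hGm.add (hGt.const_mul ((1 + ‖t‖) ^ |s|))
  refine not_memLp_one_add_norm_criticalExponent hp
    (memLp_of_continuous_of_norm_le (continuous_one_add_norm_rpow s) hsum (C := c⁻¹) (R := 0)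
      fun z _ => ?_)
  rw [Real.norm_of_nonneg (by positivity), ← div_eq_inv_mul, le_div_iff₀ hc]
  refine le_trans ?_ (Real.le_norm_self _)
  simp only [Pi.add_apply, hG]
  have h1 := one_add_norm_rpow_le s z t
  have h2 := sigmaWeight_nonneg α (z + t)
  calc (1 + ‖z‖) ^ s * c ≤ (1 + ‖z‖) ^ s * (sigmaWeight α z + sigmaWeight α (z + t)) := by
        gcongr
        exact hct z
    _ = (1 + ‖z‖) ^ s * sigmaWeight α z + (1 + ‖z‖) ^ s * sigmaWeight α (z + t) := by ring
    _ ≤ (1 + ‖z‖) ^ s * sigmaWeight α z +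
        (1 + ‖t‖) ^ |s| * (1 + ‖z + t‖) ^ s * sigmaWeight α (z + t) := by gcongr
    _ = _ := by ring

end NonMembership

/-! ### Orders of vanishing and the dimension count. -/

section VanishingSpace

variable {α : ℝ} {p : ℝ≥0∞}

lemma analyticOrderAt_sub_const (a z : ℂ) :
    analyticOrderAt (fun w : ℂ => w - a) z = if z = a then 1 else 0 := by
  have ha : AnalyticAt ℂ (fun w : ℂ => w - a) z := by fun_prop
  split_ifs with h
  · subst h
    refine (ha.analyticOrderAt_eq_natCast (n := 1)).mpr ⟨fun _ => 1, analyticAt_const, one_ne_zero,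
      Filter.Eventually.of_forall fun w => by simp⟩
  · exact ha.analyticOrderAt_eq_zero.mpr (sub_ne_zero.mpr h)

lemma analyticOrderAt_prod_sub (S : Finset ℂ) (z : ℂ) :
    analyticOrderAt (fun w : ℂ => ∏ a ∈ S, (w - a)) z = if z ∈ S then 1 else 0 := by
  classical
  induction S using Finset.induction_on with
  | empty =>
    simp only [Finset.prod_empty, Finset.notMem_empty, if_false]
    exact analyticAt_const.analyticOrderAt_eq_zero.mpr one_ne_zero
  | insert a S ha ih =>
    have h : (fun w : ℂ => ∏ b ∈ insert a S, (w - b)) =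
        (fun w : ℂ => w - a) * fun w : ℂ => ∏ b ∈ S, (w - b) := by
      ext w
      rw [Finset.prod_insert ha, Pi.mul_apply]
    rw [h, analyticOrderAt_mul (by fun_prop) (by fun_prop), ih, analyticOrderAt_sub_const]
    by_cases hz : z = a
    · subst hz
      simp [ha]
    · simp [hz]

/-- Multiplication of a function by polynomials. -/
noncomputable def polynomialMul (g : ℂ → ℂ) : Polynomial ℂ →ₗ[ℂ] (ℂ → ℂ) where
  toFun P z := g z * P.eval z
  map_add' P Q := by
    ext z
    simp [mul_add]
  map_smul' c P := by
    ext z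
    simp
    ring

lemma polynomialMul_injective {g : ℂ → ℂ} (hg : Continuous g) {z₀ : ℂ} (hz₀ : g z₀ ≠ 0) :
    Function.Injective (polynomialMul g) := by
  refine (injective_iff_map_eq_zero _).mpr fun P hP => ?_
  refine Polynomial.eq_zero_of_infinite_isRoot P ?_
  refine (infinite_of_mem_nhds z₀ (hg.continuousAt.eventually_ne hz₀)).mono fun z hz => ?_
  have h1 : g z * P.eval z = 0 := congrFun hP z
  exact (mul_eq_zero.mp h1).resolve_left hz

/-- Multiplication by `g` is injective on polynomials, so the dimension is that of the polynomials
of degree less than `k`. -/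
lemma vanishingDim_eq_of_eq_polynomialMul {Z : ℂ → ℕ} {g : ℂ → ℂ} (hg : Continuous g) {z₀ : ℂ}
    (hz₀ : g z₀ ≠ 0) {k : ℕ} (hk : 0 < k)
    (h : (vanishingSpace α p Z : Set (ℂ → ℂ)) =
      {f | ∃ h : Polynomial ℂ, h.natDegree ≤ k - 1 ∧ f = fun z => g z * h.eval z}) :
    vanishingDim α p Z = k := by
  have hV : vanishingSpace α p Z = (Polynomial.degreeLT ℂ k).map (polynomialMul g) := by
    refine SetLike.coe_injective ?_
    rw [h]
    ext f
    have hdeg : ∀ P : Polynomial ℂ, P ∈ Polynomial.degreeLT ℂ k ↔ P.natDegree ≤ k - 1 := by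
      intro P
      rw [Polynomial.mem_degreeLT, Polynomial.degree_lt_iff_coeff_zero,
        Polynomial.natDegree_le_iff_coeff_eq_zero]
      exact forall_congr' fun m => by rw [show k ≤ m ↔ k - 1 < m by omega]
    simp only [Set.mem_ofPred_eq, Submodule.map_coe, Set.mem_image, SetLike.mem_coe, hdeg]
    exact exists_congr fun P => and_congr_right fun _ => eq_comm
  have e := Submodule.equivMapOfInjective (polynomialMul g) (polynomialMul_injective hg hz₀)
    (Polynomial.degreeLT ℂ k)
  rw [vanishingDim, hV, ← e.rank_eq, (Polynomial.degreeLTEquiv ℂ k).rank_eq, rank_fin_fun]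
  simp

end VanishingSpace

/-! ### Quotients of `σ_α` and the space `I_Z`. -/

section SigmaQuotient

variable {α : ℝ} {p : ℝ≥0∞}

lemma analyticOrderAt_weierstrassSigma (hα : 0 < α) (z : ℂ) [Decidable (z ∈ squareLattice α)] :
    analyticOrderAt (weierstrassSigma α) z = if z ∈ squareLattice α then 1 else 0 := by
  rw [weierstrassSigma_eq hα]
  split_ifs with h
  · exact PeriodPair.analyticOrderAt_sigma _ ((mem_squareLattice_iff hα).mp h)
  · exact PeriodPair.analyticOrderAt_sigma_of_notMem _
      fun h' => h ((mem_squareLattice_iff hα).mpr h')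

/-- The zeros of the sigma function at finitely many lattice points can be divided out. -/
lemma exists_weierstrassSigma_eq_prod_mul (hα : 0 < α) {S : Finset ℂ}
    (hS : (S : Set ℂ) ⊆ squareLattice α) :
    ∃ g : ℂ → ℂ, Differentiable ℂ g ∧ (∀ z, weierstrassSigma α z = (∏ a ∈ S, (z - a)) * g z) ∧
      VanishesExactlyOn g (latticeMinus α S) := by
  classical
  have hP : Differentiable ℂ fun z : ℂ => ∏ a ∈ S, (z - a) := by fun_prop
  obtain ⟨g, hg, hσ⟩ := exists_eq_mul_of_analyticOrderAt_le (differentiable_weierstrassSigma hα) hP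
    (fun z => by rw [analyticOrderAt_prod_sub]; split_ifs <;> simp)
    (fun z => by
      rw [analyticOrderAt_prod_sub, analyticOrderAt_weierstrassSigma hα]
      by_cases hz : z ∈ S
      · rw [if_pos hz, if_pos (hS hz)]
      · simp [hz])
  refine ⟨g, hg, hσ, fun z => ?_⟩
  have h1 : weierstrassSigma α = (fun z : ℂ => ∏ a ∈ S, (z - a)) * g := funext hσ
  have h2 := analyticOrderAt_mul (hP.analyticAt z) (hg.analyticAt z)
  rw [← h1, analyticOrderAt_prod_sub, analyticOrderAt_weierstrassSigma hα] at h2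
  rw [latticeMinus]
  by_cases hz : z ∈ S
  · rw [if_pos hz, if_pos (hS hz)] at h2
    rw [Set.indicator_of_notMem (fun h => h.2 hz), Nat.cast_zero]
    by_cases ht : analyticOrderAt g z = ⊤
    · simp [ht] at h2
    · lift analyticOrderAt g z to ℕ using ht with n
      norm_cast at h2 ⊢
      omega
  · rw [if_neg hz, zero_add] at h2
    rw [← h2]
    by_cases hl : z ∈ squareLattice α
    · have hm : z ∈ squareLattice α \ (S : Set ℂ) := ⟨hl, hz⟩
      rw [if_pos hl, Set.indicator_of_mem hm]
      simp
    · rw [if_neg hl, Set.indicator_of_notMem fun h => hl h.1]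
      simp

variable {S : Finset ℂ} {g : ℂ → ℂ}

/-- The polynomial `∏ (X - a)` over `a ∈ S`. -/
noncomputable def nodalPolynomial (S : Finset ℂ) : Polynomial ℂ :=
  ∏ a ∈ S, (Polynomial.X - Polynomial.C a)

lemma nodalPolynomial_ne_zero (S : Finset ℂ) : nodalPolynomial S ≠ 0 :=
  (Polynomial.monic_prod_X_sub_C id S).ne_zero

lemma natDegree_nodalPolynomial (S : Finset ℂ) : (nodalPolynomial S).natDegree = S.card :=
  Polynomial.natDegree_finsetProd_X_sub_C_eq_card S id

lemma eval_nodalPolynomial (S : Finset ℂ) (z : ℂ) :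
    (nodalPolynomial S).eval z = ∏ a ∈ S, (z - a) := by
  simp [nodalPolynomial, Polynomial.eval_prod]

lemma sigmaWeight_eq (hσ : ∀ z, weierstrassSigma α z = (∏ a ∈ S, (z - a)) * g z) (z : ℂ) :
    sigmaWeight α z =
      ‖(nodalPolynomial S).eval z‖ * (‖g z‖ * Real.exp (-(α / 2) * ‖z‖ ^ 2)) := by
  rw [sigmaWeight, hσ, norm_mul, eval_nodalPolynomial, mul_assoc]

/-- The weight is bounded above and the nodal polynomial has full growth, so the weighted size of `g
* P` is `O(|z| ^ (deg P - |S|))`, hence `O(|z| ^ (-N))`. -/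
lemma mul_polynomial_mem_fockSpace (hα : 0 < α) (hp : 0 < p) (hg : Differentiable ℂ g)
    (hσ : ∀ z, weierstrassSigma α z = (∏ a ∈ S, (z - a)) * g z) {P : Polynomial ℂ}
    (hP : criticalExponent p + P.natDegree ≤ S.card) :
    (fun z => g z * P.eval z) ∈ fockSpace α p := by
  obtain ⟨C, hC, hsC⟩ := exists_sigmaWeight_le hα
  obtain ⟨c, hc, R, hR, hN⟩ := Polynomial.exists_le_norm_eval (nodalPolynomial_ne_zero S)
  obtain ⟨K, hK, hPK⟩ := P.exists_norm_eval_le le_rfl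
  refine mem_fockSpace_of_norm_le hp (hg.mul P.differentiable) (C := C * K / c) (R := R)
    fun z hz => ?_
  have h1 := hN z hz
  rw [natDegree_nodalPolynomial] at h1
  have h2 := (sigmaWeight_eq hσ z).symm.trans_le (hsC z)
  set x := 1 + ‖z‖ with hx
  have hx1 : 1 ≤ x := by linarith [norm_nonneg z]
  have hx0 : 0 < x := by linarith
  set G := ‖g z‖ * Real.exp (-(α / 2) * ‖z‖ ^ 2) with hG
  have hG0 : 0 ≤ G := by positivity
  have h3 : c * x ^ S.card * G ≤ C := (mul_le_mul_of_nonneg_right h1 hG0).trans h2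
  rw [norm_mul, mul_right_comm, Real.rpow_neg hx0.le, Real.rpow_natCast, ← div_eq_mul_inv,
    le_div_iff₀ (by positivity), le_div_iff₀ hc]
  calc G * ‖P.eval z‖ * x ^ criticalExponent p * c
      ≤ G * (K * x ^ P.natDegree) * x ^ criticalExponent p * c := by
        gcongr
        exact hPK z
    _ = c * x ^ (criticalExponent p + P.natDegree) * G * K := by rw [pow_add]; ring
    _ ≤ c * x ^ S.card * G * K := by gcongr
    _ ≤ C * K := by gcongr

/-- Here the weighted size of `g * P` is at least a multiple of `|z| ^ (deg P - |S|)` times the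
periodic weight, with exponent at least `1 - N`. -/
lemma mul_polynomial_notMem_fockSpace (hα : 0 < α) (hp : 0 < p)
    (hσ : ∀ z, weierstrassSigma α z = (∏ a ∈ S, (z - a)) * g z) {P : Polynomial ℂ} (hP0 : P ≠ 0)
    (hP : S.card + 1 ≤ criticalExponent p + P.natDegree) :
    (fun z => g z * P.eval z) ∉ fockSpace α p := by
  obtain ⟨K, hK, hNK⟩ := (nodalPolynomial S).exists_norm_eval_le (natDegree_nodalPolynomial S).le
  obtain ⟨c, hc, R, hR, hPc⟩ := Polynomial.exists_le_norm_eval hP0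
  refine notMem_fockSpace_of_le hα hp (C := K / c) (R := R) fun z hz => ?_
  have h1 := hPc z hz
  rw [sigmaWeight_eq hσ, norm_mul, mul_right_comm ‖g z‖]
  set x := 1 + ‖z‖ with hx
  have hx1 : 1 ≤ x := by linarith [norm_nonneg z]
  have hx0 : 0 < x := by linarith
  set G := ‖g z‖ * Real.exp (-(α / 2) * ‖z‖ ^ 2) with hG
  have hG0 : 0 ≤ G := by positivity
  have h2 : x ^ (1 - (criticalExponent p : ℝ)) * x ^ S.card ≤ x ^ P.natDegree := by
    rw [← Real.rpow_natCast, ← Real.rpow_natCast, ← Real.rpow_add hx0]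
    refine Real.rpow_le_rpow_of_exponent_le hx1 ?_
    have : (S.card : ℝ) + 1 ≤ criticalExponent p + P.natDegree := by exact_mod_cast hP
    linarith
  calc x ^ (1 - (criticalExponent p : ℝ)) * (‖(nodalPolynomial S).eval z‖ * G)
      ≤ x ^ (1 - (criticalExponent p : ℝ)) * (K * x ^ S.card * G) := by
        gcongr
        exact hNK z
    _ = K * G * (x ^ (1 - (criticalExponent p : ℝ)) * x ^ S.card) := by ring
    _ ≤ K * G * x ^ P.natDegree := by gcongr
    _ = K / c * (G * (c * x ^ P.natDegree)) := by field_simp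
    _ ≤ K / c * (G * ‖P.eval z‖) := by gcongr

/-- A function of the Fock space that is an entire multiple of `g` is a polynomial multiple. -/
lemma exists_polynomial_of_mul_mem_fockSpace (hα : 0 < α) (hp : 0 < p)
    (hσ : ∀ z, weierstrassSigma α z = (∏ a ∈ S, (z - a)) * g z) {h : ℂ → ℂ}
    (hh : Differentiable ℂ h) (hf : (fun z => g z * h z) ∈ fockSpace α p) :
    ∃ P : Polynomial ℂ, ∀ z, h z = P.eval z := by
  obtain ⟨C, hC, hfC⟩ := exists_norm_le_of_mem_fockSpace hα hp hf
  obtain ⟨K, hK, hNK⟩ := (nodalPolynomial S).exists_norm_eval_le (natDegree_nodalPolynomial S).le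
  obtain ⟨c, hc, hcs⟩ := exists_le_sigmaWeight hα
  have ha := latticeMesh_pos hα
  set r := 3 / 4 * latticeMesh α with hr
  have hr0 : 0 < r := by positivity
  refine exists_polynomial_of_norm_le hh (C := C * K / c * (1 + 2 * r) ^ S.card) (M := S.card)
    fun z => ?_
  obtain ⟨l, hl, hz⟩ := exists_norm_sub_le_latticeMesh hα z
  -- Near zeros of `σ_α` division gives no bound on `h`. The estimate is made on a circle around the
  -- nearest lattice point, where the weight is bounded below, and the maximum principle carries it
  -- to `z`.
  have hfr : ∀ w ∈ frontier (Metric.ball l r),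
      ‖h w‖ ≤ C * K / c * (1 + 2 * r) ^ S.card * (1 + ‖z‖) ^ S.card := by
    intro w hw
    rw [frontier_ball l hr0.ne', mem_sphere_iff_norm] at hw
    have h1 := hcs l hl w hw
    rw [sigmaWeight_eq hσ] at h1
    have h2 := hfC w
    rw [norm_mul, mul_right_comm] at h2
    set G := ‖g w‖ * Real.exp (-(α / 2) * ‖w‖ ^ 2)
    have hG0 : 0 ≤ G := by positivity
    have h3 : 1 + ‖w‖ ≤ (1 + 2 * r) * (1 + ‖z‖) := by
      have h4 : ‖w‖ ≤ ‖w - l‖ + ‖z - l‖ + ‖z‖ := by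
        calc ‖w‖ = ‖(w - l) - (z - l) + z‖ := by congr 1; ring
          _ ≤ ‖(w - l) - (z - l)‖ + ‖z‖ := norm_add_le _ _
          _ ≤ _ := by gcongr; exact norm_sub_le _ _
      nlinarith [norm_nonneg z, mul_nonneg hr0.le (norm_nonneg z)]
    have h5 : c * ‖h w‖ ≤ K * (1 + ‖w‖) ^ S.card * C := by
      calc c * ‖h w‖ ≤ ‖(nodalPolynomial S).eval w‖ * G * ‖h w‖ := by gcongr
        _ = ‖(nodalPolynomial S).eval w‖ * (G * ‖h w‖) := by ring
        _ ≤ K * (1 + ‖w‖) ^ S.card * C := by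
          gcongr
          exact hNK w
    calc ‖h w‖ ≤ K * (1 + ‖w‖) ^ S.card * C / c := by
          rw [le_div_iff₀ hc, mul_comm]
          exact h5
      _ ≤ K * ((1 + 2 * r) * (1 + ‖z‖)) ^ S.card * C / c := by gcongr
      _ = _ := by rw [mul_pow]; ring
  refine Complex.norm_le_of_forall_mem_frontier_norm_le Metric.isBounded_ball hh.diffContOnCl hfr ?_
  rw [closure_ball l hr0.ne', mem_closedBall_iff_norm]
  exact hz

/-- The space `I_Z` for the lattice with finitely many points removed. -/
theorem vanishingSpace_latticeMinus_eq (hα : 0 < α) (hp : 0 < p) {k : ℕ}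
    (hcard : S.card = criticalExponent p + (k - 1)) (hg : Differentiable ℂ g)
    (hσ : ∀ z, weierstrassSigma α z = (∏ a ∈ S, (z - a)) * g z)
    (hZ : VanishesExactlyOn g (latticeMinus α S)) :
    (vanishingSpace α p (latticeMinus α S) : Set (ℂ → ℂ)) =
      {f | ∃ h : Polynomial ℂ, h.natDegree ≤ k - 1 ∧ f = fun z => g z * h.eval z} := by
  ext f
  simp only [SetLike.mem_coe, Set.mem_ofPred_eq]
  constructor
  · rintro ⟨hf, hfZ⟩
    obtain ⟨h, hh, hfh⟩ := exists_eq_mul_of_analyticOrderAt_le hf.1 hg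
      (fun z => by rw [hZ z]; exact ENat.natCast_ne_top _) (fun z => by rw [hZ z]; exact hfZ z)
    obtain rfl : f = fun z => g z * h z := funext hfh
    obtain ⟨P, hP⟩ := exists_polynomial_of_mul_mem_fockSpace hα hp hσ hh hf
    obtain rfl : h = fun z => P.eval z := funext hP
    refine ⟨P, ?_, rfl⟩
    by_contra! hdeg
    refine mul_polynomial_notMem_fockSpace hα hp hσ (P := P) ?_ (by omega) hf
    rintro rfl
    simp at hdeg
  · rintro ⟨P, hP, rfl⟩
    refine ⟨mul_polynomial_mem_fockSpace hα hp hg hσ (by omega), fun z => ?_⟩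
    have h1 := analyticOrderAt_mul (hg.analyticAt z) (P.differentiable.analyticAt z)
    rw [show (fun z => g z * P.eval z) = g * fun z => P.eval z from rfl, h1, hZ z]
    exact le_self_add

lemma exists_ne_zero_of_vanishesExactlyOn {Z : ℂ → ℕ} (hZ : VanishesExactlyOn g Z) :
    ∃ z, g z ≠ 0 := by
  by_contra! h
  have h1 : analyticOrderAt g 0 = ⊤ :=
    analyticOrderAt_eq_top.mpr (Filter.Eventually.of_forall h)
  rw [hZ 0] at h1
  exact ENat.natCast_ne_top _ h1

theorem isZeroSequence_latticeMinus (hα : 0 < α) (hp : 0 < p) {k : ℕ}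
    (hcard : S.card = criticalExponent p + (k - 1)) (hg : Differentiable ℂ g)
    (hσ : ∀ z, weierstrassSigma α z = (∏ a ∈ S, (z - a)) * g z)
    (hZ : VanishesExactlyOn g (latticeMinus α S)) : IsZeroSequence α p (latticeMinus α S) := by
  refine ⟨g, ?_, ?_, hZ⟩
  · have := mul_polynomial_mem_fockSpace hα hp hg hσ (P := 1) (by simp; omega)
    simpa using this
  · obtain ⟨z, hz⟩ := exists_ne_zero_of_vanishesExactlyOn hZ
    exact fun h => hz (congrFun h z)

lemma exists_finset_squareLattice (hα : 0 < α) (n : ℕ) :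
    ∃ S : Finset ℂ, (S : Set ℂ) ⊆ squareLattice α ∧ S.card = n := by
  have h : (squareLattice α).Infinite := Set.infinite_range_of_injective (latticePoint_injective hα)
  exact h.exists_subset_card_eq n

end SigmaQuotient

/-! ### The empty sequence: infinite dimension. -/

section EmptySequence

variable {α : ℝ} {p : ℝ≥0∞}

lemma polynomial_mem_fockSpace (hα : 0 < α) (hp : 0 < p) (P : Polynomial ℂ) :
    (fun z => P.eval z) ∈ fockSpace α p := by
  obtain ⟨K, hK, hPK⟩ := P.exists_norm_eval_le le_rfl
  set m := P.natDegree + criticalExponent p with hm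
  refine mem_fockSpace_of_norm_le hp P.differentiable
    (C := K * (2 ^ m * (m.factorial * (2 / α) ^ m))) (R := 1) fun z hz => ?_
  have hx0 : 0 < 1 + ‖z‖ := by positivity
  have h1 : (1 + ‖z‖) ^ m * Real.exp (-(α / 2) * ‖z‖ ^ 2) ≤
      2 ^ m * (m.factorial * (2 / α) ^ m) := by
    -- The inequality `x ^ m / m! ≤ exp x` at `x = α / 2 * ‖z‖ ^ 2`, combined with `1 + ‖z‖ ≤ 2 *
    -- ‖z‖ ^ 2` for `‖z‖ ≥ 1`.
    have h2 := Real.pow_div_factorial_le_exp (α / 2 * ‖z‖ ^ 2) (by positivity) m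
    rw [neg_mul, Real.exp_neg, ← div_eq_mul_inv, div_le_iff₀ (Real.exp_pos _)]
    calc (1 + ‖z‖) ^ m ≤ (2 * ‖z‖ ^ 2) ^ m := by
          gcongr
          nlinarith
      _ = 2 ^ m * (m.factorial * (2 / α) ^ m) * ((α / 2 * ‖z‖ ^ 2) ^ m / m.factorial) := by
          rw [mul_pow, mul_pow, div_pow, div_pow]
          field_simp
      _ ≤ _ := by gcongr
  rw [Real.rpow_neg hx0.le, Real.rpow_natCast, ← div_eq_mul_inv, le_div_iff₀ (by positivity)]
  calc ‖P.eval z‖ * Real.exp (-(α / 2) * ‖z‖ ^ 2) * (1 + ‖z‖) ^ criticalExponent p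
      ≤ K * (1 + ‖z‖) ^ P.natDegree * Real.exp (-(α / 2) * ‖z‖ ^ 2) *
        (1 + ‖z‖) ^ criticalExponent p := by
        gcongr
        exact hPK z
    _ = K * ((1 + ‖z‖) ^ m * Real.exp (-(α / 2) * ‖z‖ ^ 2)) := by rw [hm, pow_add]; ring
    _ ≤ _ := by gcongr

theorem isZeroSequence_zero (hα : 0 < α) (hp : 0 < p) : IsZeroSequence α p 0 := by
  refine ⟨fun _ => 1, ?_, ?_, fun z => ?_⟩
  · simpa using polynomial_mem_fockSpace hα hp (1 : Polynomial ℂ)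
  · exact fun h => one_ne_zero (congrFun h 0)
  · rw [Pi.zero_apply, Nat.cast_zero]
    exact analyticAt_const.analyticOrderAt_eq_zero.mpr one_ne_zero

theorem vanishingDim_zero (hα : 0 < α) (hp : 0 < p) : vanishingDim α p 0 = ⊤ := by
  have hmem : ∀ P : Polynomial ℂ, polynomialMul (fun _ => 1) P ∈ vanishingSpace α p 0 := by
    intro P
    refine ⟨?_, fun z => by simp⟩
    have := polynomial_mem_fockSpace hα hp P
    simpa [polynomialMul] using this
  have hinj : Function.Injective
      ((polynomialMul fun _ => 1).codRestrict (vanishingSpace α p 0) hmem) := by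
    intro P Q h
    exact polynomialMul_injective continuous_const (z₀ := 0) one_ne_zero
      (congrArg Subtype.val h)
  have h := LinearMap.rank_le_of_injective _ hinj
  rw [vanishingDim, Cardinal.toENat_eq_top]
  refine le_trans ?_ h
  rw [← (Polynomial.basisMonomials ℂ).mk_eq_rank'']
  simp

end EmptySequence

/-! ### Maximality. -/

section Maximal

variable {α : ℝ} {p : ℝ≥0∞}

/-- A zero of a function in the Fock space can be divided out. -/
lemma mem_fockSpace_of_sub_mul_mem {q : ℂ → ℂ} (hq : Differentiable ℂ q) {a : ℂ}
    (h : (fun z => (z - a) * q z) ∈ fockSpace α p) : q ∈ fockSpace α p := by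
  refine ⟨hq, memLp_of_continuous_of_norm_le (continuous_mul_gaussian hq.continuous α) h.2
    (C := 1) (R := ‖a‖ + 1) fun z hz => ?_⟩
  have h1 : 1 ≤ ‖z - a‖ := by linarith [norm_sub_norm_le z a]
  rw [norm_mul_gaussian, norm_mul_gaussian, norm_mul, one_mul]
  gcongr
  exact le_mul_of_one_le_left (norm_nonneg _) h1

/-- Both `f` and `q = f / (z - a)` lie in `I_Z`. One-dimensionality makes them proportional, so `z -
a` is constant on the nonempty open set where `q ≠ 0`. -/
theorem not_isZeroSequence_adjoinPoint {Z : ℂ → ℕ} (hdim : vanishingDim α p Z = 1) (a : ℂ) :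
    ¬ IsZeroSequence α p (adjoinPoint Z a) := by
  rintro ⟨f, hf, hf0, hfZ⟩
  have hsub : Differentiable ℂ fun z : ℂ => z - a := by fun_prop
  have hfZ' : ∀ z, analyticOrderAt f z = Z z + if z = a then 1 else 0 := by
    intro z
    rw [hfZ z, adjoinPoint, Pi.add_apply, Pi.single_apply]
    push_cast
    rfl
  obtain ⟨q, hq, hfq⟩ := exists_eq_mul_of_analyticOrderAt_le hf.1 hsub
    (fun z => by rw [analyticOrderAt_sub_const]; split_ifs <;> simp)
    (fun z => by rw [analyticOrderAt_sub_const, hfZ' z]; exact le_add_self)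
  have hfeq : f = (fun z : ℂ => z - a) * q := funext hfq
  have hfV : f ∈ vanishingSpace α p Z := ⟨hf, fun z => by rw [hfZ' z]; exact le_self_add⟩
  have hqV : q ∈ vanishingSpace α p Z := by
    refine ⟨mem_fockSpace_of_sub_mul_mem hq (a := a) (by rwa [hfeq] at hf), fun z => ?_⟩
    have h1 := hfZ' z
    rw [hfeq, analyticOrderAt_mul (hsub.analyticAt z) (hq.analyticAt z),
      analyticOrderAt_sub_const, add_comm] at h1
    refine ((ENat.add_left_injective_of_ne_top ?_) h1).ge
    split_ifs <;> simp
  have hrank : Module.rank ℂ (vanishingSpace α p Z) ≤ 1 := by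
    rw [vanishingDim, Cardinal.toENat_eq_one] at hdim
    exact hdim.le
  obtain ⟨⟨v, hv⟩, hspan⟩ := rank_le_one_iff.mp hrank
  obtain ⟨r, hr⟩ := hspan ⟨f, hfV⟩
  obtain ⟨s, hs⟩ := hspan ⟨q, hqV⟩
  have hr' : ∀ z, r * v z = (z - a) * q z := fun z => by
    rw [← hfq z]
    exact congrFun (congrArg Subtype.val hr) z
  have hs' : ∀ z, s * v z = q z := fun z => congrFun (congrArg Subtype.val hs) z
  obtain ⟨z₀, hz₀⟩ : ∃ z, q z ≠ 0 := by
    by_contra! h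
    refine hf0 (funext fun z => ?_)
    rw [hfq, h, mul_zero, Pi.zero_apply]
  have hs0 : s ≠ 0 := by
    rintro rfl
    rw [← hs' z₀, zero_mul] at hz₀
    exact hz₀ rfl
  have hconst : ∀ z, q z ≠ 0 → z = a + r / s := by
    intro z hz
    have h1 : s * ((z - a) * q z) = r * q z := by
      rw [← hr', ← hs']
      ring
    have h2 : s * (z - a) = r := mul_right_cancel₀ hz (by linear_combination h1)
    field_simp
    linear_combination h2
  refine (infinite_of_mem_nhds z₀ (hq.continuous.continuousAt.eventually_ne hz₀)) ?_
  exact (Set.finite_singleton (a + r / s)).subset fun z hz => hconst z hz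

end Maximal

/-! ### The main theorem. -/

theorem theorem4 (α : ℝ) (hα : 0 < α) (p : ℝ≥0∞) (hp : 0 < p) :
    (∀ k : ℕ∞, 0 < k → ∃ Z : ℂ → ℕ, IsZeroSequence α p Z ∧ vanishingDim α p Z = k) ∧
    (∀ k : ℕ, 0 < k → ∀ S : Finset ℂ, (S : Set ℂ) ⊆ squareLattice α →
      S.card = criticalExponent p + (k - 1) →
        IsZeroSequence α p (latticeMinus α S) ∧
        vanishingDim α p (latticeMinus α S) = k ∧
        ∃ g : ℂ → ℂ, Differentiable ℂ g ∧
          (∀ z, z ∉ S → g z = weierstrassSigma α z / ∏ a ∈ S, (z - a)) ∧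
          VanishesExactlyOn g (latticeMinus α S) ∧
          (vanishingSpace α p (latticeMinus α S) : Set (ℂ → ℂ)) =
            {f | ∃ h : Polynomial ℂ, h.natDegree ≤ k - 1 ∧ f = fun z => g z * h.eval z}) ∧
    (∀ Z : ℂ → ℕ, IsZeroSequence α p Z → vanishingDim α p Z = 1 →
      IsMaximalZeroSequence α p Z) := by
  have part2 : ∀ k : ℕ, 0 < k → ∀ S : Finset ℂ, (S : Set ℂ) ⊆ squareLattice α →
      S.card = criticalExponent p + (k - 1) →
        IsZeroSequence α p (latticeMinus α S) ∧
        vanishingDim α p (latticeMinus α S) = k ∧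
        ∃ g : ℂ → ℂ, Differentiable ℂ g ∧
          (∀ z, z ∉ S → g z = weierstrassSigma α z / ∏ a ∈ S, (z - a)) ∧
          VanishesExactlyOn g (latticeMinus α S) ∧
          (vanishingSpace α p (latticeMinus α S) : Set (ℂ → ℂ)) =
            {f | ∃ h : Polynomial ℂ, h.natDegree ≤ k - 1 ∧ f = fun z => g z * h.eval z} := by
    intro k hk S hS hcard
    obtain ⟨g, hg, hσ, hZ⟩ := exists_weierstrassSigma_eq_prod_mul hα hS
    have hV := vanishingSpace_latticeMinus_eq hα hp hcard hg hσ hZ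
    obtain ⟨z₀, hz₀⟩ := exists_ne_zero_of_vanishesExactlyOn hZ
    refine ⟨isZeroSequence_latticeMinus hα hp hcard hg hσ hZ,
      vanishingDim_eq_of_eq_polynomialMul hg.continuous hz₀ hk hV, g, hg, fun z hz => ?_, hZ, hV⟩
    have h0 : ∏ a ∈ S, (z - a) ≠ 0 := by
      refine Finset.prod_ne_zero_iff.mpr fun a ha => sub_ne_zero.mpr ?_
      rintro rfl
      exact hz ha
    rw [hσ z, mul_div_cancel_left₀ _ h0]
  refine ⟨fun k hk => ?_, part2, fun Z hZ hdim =>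
    ⟨hZ, fun a => not_isZeroSequence_adjoinPoint hdim a, hdim⟩⟩
  -- The empty sequence serves `k = ∞`; finite `k` comes from removing `N + k - 1` lattice points.
  by_cases hk' : k = ⊤
  · subst hk'
    exact ⟨0, isZeroSequence_zero hα hp, vanishingDim_zero hα hp⟩
  · lift k to ℕ using hk'
    obtain ⟨S, hS, hcard⟩ := exists_finset_squareLattice hα (criticalExponent p + (k - 1))
    have h := part2 k (by exact_mod_cast hk) S hS hcard
    exact ⟨_, h.1, h.2.1⟩
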